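/- Setting. Let $N$ be a lattice of rank $n\ge 0$, $V=N\otimes\mathbb R$, $V^*=\mathrm{Hom}(V,\mathbb R)$, $N^*=\mathrm{Hom}(N,\mathbb Z)\subset V^*$. A simplicial multi-fan $\Delta=(\Sigma,C,w^\pm)$ in $V$ consists of a finite family $\Sigma$ of finite subsets of an index set, containing $\emptyset$ and closed under taking subsets (the vertices being the $i$ with $\{i\}\in\Sigma$), vectors $v_i\in V$ such that $(v_i)_{i\in I}$ is linearly independent for every $I\in\Sigma$, the cones $C(I)=\{\sum_{i\in I}r_iv_i : r_i\ge 0\}$, and functions $w^\pm:\Sigma^{(n)}\to\mathbb Z_{\ge 0}$, not both zero at any $I$, where $\Sigma^{(n)}=\{I\in\Sigma: |I|=n\}$. Put $w=w^+-w^-$. A vector $v\in V$ is generic if it lies in no linear subspace spanned by a cone $C(I)$ with $I\in\Sigma$, $|I|<n$; then $d_v=\sum_{I\in\Sigma^{(n)},\,v\in C(I)}w(I)$. $\Delta$ is pre-complete if $\Sigma^{(n)}\ne\emptyset$ and $d_v$ is the same integer for all generic $v$; this integer is $\deg(\Delta)$. For $K\in\Sigma$ the projected multi-fan $\Delta_K$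 in $V/\mathrm{span}\,C(K)$ is given by $\{I\in\Sigma: K\subseteq I\}$ (identified with the link of $K$ by $I\mapsto I\setminus K$), the images of the vectors $v_i$, and the restrictions of $w^\pm$. $\Delta$ is complete if it is pre-complete and $\Delta_K$ is pre-complete for every $K\in\Sigma$. A simple multi-polytope $\mathcal P=(\Delta,\mathcal F)$ of dimension $n$ is a complete simplicial multi-fan in which $v_i$ is a primitive vector of $N$ for each vertex $i$, together with affine hyperplanes $F_i=\{u\in V^*:\langle u,v_i\rangle=c_i\}$, $c_i\in\mathbb R$. For $I\in\Sigma^{(n)}$ let $u_I$ be the point $\bigcap_{i\in I}F_i$ and $(u^I_i)_{i\in I}$ the basis of $V^*$ dual to $(v_i)_{i\in I}$. $\mathcal P$ is a lattice multi-polytope if $u_I\in N^*$ for all $I\in\Sigma^{(n)}$. For a generic $v$ put $(u_i^I)^+=\pm u_i^I$, with the sign that makes $\langle (u_i^I)^+,v\rangle>0$, let $(-1)^I=(-1)^{\#\{i\in I:\langle u^I_i,v\rangle>0\}}$, and let $\phi_I$ be the characteristic function of the cone with apex $u_I$ spanned by the $(u_i^I)^+$, $i\in I$. The Duistermaat–Heckman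 function is $$\mathrm{DH}_{\mathcal P}=\sum_{I\in\Sigma^{(n)}}(-1)^I\,w(I)\,\phi_I ,$$ considered off the hyperplanes $F_i$. Let $\mathcal P_\pm$ denote a multi-polytope obtained from $\mathcal P$ by replacing each $c_i$ by $c_i\pm\varepsilon_i$ with sufficiently small $\varepsilon_i>0$, and for an integer $\nu$ let $\nu\mathcal P$ be obtained by replacing each $c_i$ by $\nu c_i$. Put $$\sharp(\mathcal P)=\sum_{u\in N^*}\mathrm{DH}_{\mathcal P_+}(u),\qquad \sharp(\mathcal P^\circ)=\sum_{u\in N^*}\mathrm{DH}_{\mathcal P_-}(u),\qquad \mathrm{vol}(\mathcal P)=\int_{V^*}\mathrm{DH}_{\mathcal P}\,dV^*,$$ where $dV^*$ is normalized so that the unit cube of a basis of $N^*$ has volume $1$. Theorem 7.2. Let $\mathcal P=(\Delta,\mathcal F)$ be a simple lattice multi-polytope of dimension $n$. For every $\nu\in\mathbb Z$ the numbers $\sharp(\nu\mathcal P)$ and $\sharp(\nu\mathcal P^\circ):=\sharp((\nu\mathcal P)^\circ)$ are well defined (the sums are finite and do not depend on the generic vector or on the small displacements $\varepsilon_i$),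 $\mathrm{DH}_{\mathcal P}$ is integrable with an integral that does not depend on the generic vector, and: 1. $\sharp(\nu\mathcal P)$ and $\sharp(\nu\mathcal P^\circ)$, as functions of $\nu\in\mathbb Z$, are polynomials in $\nu$ of degree at most $n$. 2. $\sharp(\nu\mathcal P^\circ)=(-1)^n\,\sharp(-\nu\mathcal P)$ for every integer $\nu$. 3. The coefficient of $\nu^n$ in $\sharp(\nu\mathcal P)$ is $\mathrm{vol}(\mathcal P)$, and its constant term is $\deg(\Delta)$. -/

import Mathlib

noncomputable section

/-- A simplicial multi-fan `(Σ, C, w⁺, w⁻)` in a finite dimensional real vector space `V`.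
`Σ` is a finite augmented simplicial set, i.e. a family of finite subsets of `ι` that contains the
empty set and is closed under taking subsets; its vertices are the `i` with `{i} ∈ Σ`.
The cone `C(I)` is spanned by the linearly independent vectors `edge i`, `i ∈ I` (see
`SimplicialMultiFan.cone`), so that `I ↦ C(I)` identifies the subsets of `I` with the faces of
`C(I)`.  Only the values of `wPos` and `wNeg` on the `I ∈ Σ` with `|I| = dim V` matter. -/
structure SimplicialMultiFan (V : Type*) [AddCommGroup V] [Module ℝ V] [FiniteDimensional ℝ V]
    (ι : Type*) [DecidableEq ι] where
  /-- the augmented simplicial set `Σ` -/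
  simplices : Finset (Finset ι)
  empty_mem : ∅ ∈ simplices
  down_closed : ∀ I ∈ simplices, ∀ J ⊆ I, J ∈ simplices
  /-- a nonzero vector on each one-dimensional cone -/
  edge : ι → V
  linearIndepOn : ∀ I ∈ simplices, LinearIndepOn ℝ edge (I : Set ι)
  /-- the weight `w⁺` -/
  wPos : Finset ι → ℕ
  /-- the weight `w⁻` -/
  wNeg : Finset ι → ℕ
  weight_pos : ∀ I ∈ simplices, I.card = Module.finrank ℝ V → 0 < wPos I ∨ 0 < wNeg I

namespace SimplicialMultiFan

variable {V : Type*} [AddCommGroup V] [Module ℝ V] [FiniteDimensional ℝ V]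
  {ι : Type*} [DecidableEq ι]

/-- `Σ⁽ⁿ⁾`, where `n = dim V`. -/
def facets (Δ : SimplicialMultiFan V ι) : Finset (Finset ι) :=
  Δ.simplices.filter fun I => I.card = Module.finrank ℝ V

/-- `w = w⁺ - w⁻`. -/
def weight (Δ : SimplicialMultiFan V ι) (I : Finset ι) : ℤ :=
  (Δ.wPos I : ℤ) - (Δ.wNeg I : ℤ)

/-- The cone `C(I)` spanned by the `edge i`, `i ∈ I`. -/
def cone (Δ : SimplicialMultiFan V ι) (I : Finset ι) : Set V :=
  {x | ∃ r : ι → ℝ, (∀ i ∈ I, 0 ≤ r i) ∧ x = ∑ i ∈ I, r i • Δ.edge i}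

/-- `v` lies on no linear subspace spanned by a cone of dimension less than `dim V`. -/
def IsGeneric (Δ : SimplicialMultiFan V ι) (v : V) : Prop :=
  ∀ I ∈ Δ.simplices, I.card < Module.finrank ℝ V →
    v ∉ Submodule.span ℝ (Δ.edge '' (I : Set ι))

open Classical in
/-- `d_v`, the sum of `w(I)` over the `I ∈ Σ⁽ⁿ⁾` with `v ∈ C(I)`. -/
def degreeAt (Δ : SimplicialMultiFan V ι) (v : V) : ℤ :=
  ∑ I ∈ Δ.facets.filter (fun I => v ∈ Δ.cone I), Δ.weight I

/-- `Σ⁽ⁿ⁾` is nonempty and `d_v` does not depend on the generic vector `v`. -/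
def IsPreComplete (Δ : SimplicialMultiFan V ι) : Prop :=
  Δ.facets.Nonempty ∧
    ∀ v v' : V, Δ.IsGeneric v → Δ.IsGeneric v' → Δ.degreeAt v = Δ.degreeAt v'

theorem exists_isGeneric (Δ : SimplicialMultiFan V ι) : ∃ v : V, Δ.IsGeneric v := by
  classical
  let s : Finset (Submodule ℝ V) :=
    (Δ.simplices.filter fun I => I.card < Module.finrank ℝ V).image
      fun I : Finset ι => Submodule.span ℝ (Δ.edge '' (I : Set ι))
  have hs : ⊤ ∉ s := by
    intro h
    obtain ⟨I, hI, hI'⟩ := Finset.mem_image.1 h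
    have hlt := (Finset.mem_filter.1 hI).2
    have hle : Module.finrank ℝ (Submodule.span ℝ (Δ.edge '' (I : Set ι))) ≤ I.card := by
      rw [← Finset.coe_image]
      exact (finrank_span_finset_le_card _).trans Finset.card_image_le
    rw [hI', finrank_top] at hle
    omega
  obtain ⟨v, hv⟩ := (Set.ne_univ_iff_exists_notMem _).1 (Subspace.biUnion_ne_univ_of_top_notMem hs)
  refine ⟨v, fun I hI hlt hmem => hv ?_⟩
  exact Set.mem_biUnion
    (Finset.mem_image.2 ⟨I, Finset.mem_filter.2 ⟨hI, hlt⟩, rfl⟩) hmem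

/-- The degree of a multi-fan: the value of `d_v` at a generic vector.  It is independent of the
generic vector when the multi-fan is pre-complete. -/
def degree (Δ : SimplicialMultiFan V ι) : ℤ :=
  Δ.degreeAt (Classical.choose Δ.exists_isGeneric)

/-- The linear span of `C(K)`. -/
abbrev coneSpan (Δ : SimplicialMultiFan V ι) (K : Finset ι) : Submodule ℝ V :=
  Submodule.span ℝ (Δ.edge '' (K : Set ι))

theorem finrank_coneSpan (Δ : SimplicialMultiFan V ι) {K : Finset ι} (hK : K ∈ Δ.simplices) :
    Module.finrank ℝ (Δ.coneSpan K) = K.card := by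
  have h := finrank_span_eq_card (R := ℝ) (Δ.linearIndepOn K hK)
  rw [← Set.image_eq_range] at h
  simpa using h

/-- The projected multi-fan `Δ_K` in `V / span C(K)`.  The set `Σ_K = {I ∈ Σ | K ⊆ I}` is
identified with the link of `K` through `I = J ∪ K`. -/
def proj (Δ : SimplicialMultiFan V ι) (K : Finset ι) (hK : K ∈ Δ.simplices) :
    SimplicialMultiFan (V ⧸ Δ.coneSpan K) ι where
  simplices := Δ.simplices.filter fun J => Disjoint J K ∧ J ∪ K ∈ Δ.simplices
  empty_mem := by simpa [Δ.empty_mem] using hK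
  down_closed := by
    intro I hI J hJ
    obtain ⟨h1, h2, h3⟩ := Finset.mem_filter.1 hI
    exact Finset.mem_filter.2 ⟨Δ.down_closed I h1 J hJ, Finset.disjoint_of_subset_left hJ h2,
      Δ.down_closed _ h3 _ (Finset.union_subset_union_left hJ)⟩
  edge := fun i => (Δ.coneSpan K).mkQ (Δ.edge i)
  linearIndepOn := by
    intro J hJ
    obtain ⟨_, h2, h3⟩ := Finset.mem_filter.1 hJ
    have hd : Disjoint (K : Set ι) (J : Set ι) := by exact_mod_cast h2.symm
    refine ((Δ.linearIndepOn K hK).quotient_iff_union hd).2 ?_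
    have h := Δ.linearIndepOn _ h3
    rwa [Finset.coe_union, Set.union_comm] at h
  wPos := fun J => Δ.wPos (J ∪ K)
  wNeg := fun J => Δ.wNeg (J ∪ K)
  weight_pos := by
    intro J hJ hcard
    obtain ⟨_, h2, h3⟩ := Finset.mem_filter.1 hJ
    refine Δ.weight_pos _ h3 ?_
    have h := (Δ.coneSpan K).finrank_quotient_add_finrank
    rw [Δ.finrank_coneSpan hK, ← hcard] at h
    rw [Finset.card_union_of_disjoint h2, h]

/-- A pre-complete multi-fan is complete if all its projected multi-fans are pre-complete. -/
def IsComplete (Δ : SimplicialMultiFan V ι) : Prop :=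
  Δ.IsPreComplete ∧ ∀ (K : Finset ι) (hK : K ∈ Δ.simplices), (Δ.proj K hK).IsPreComplete

/-- For `I ∈ Σ⁽ⁿ⁾`, the basis `(v_i)_{i ∈ I}` of `V`. -/
def facetBasis (Δ : SimplicialMultiFan V ι) (I : Δ.facets) : Module.Basis I.1 ℝ V :=
  basisOfLinearIndependentOfCardEqFinrank' (fun i : I.1 => Δ.edge i)
    (Δ.linearIndepOn I.1 (Finset.mem_filter.1 I.2).1)
    (by simpa using (Finset.mem_filter.1 I.2).2)

theorem facetBasis_apply (Δ : SimplicialMultiFan V ι) (I : Δ.facets) (i : I.1) :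
    Δ.facetBasis I i = Δ.edge i :=
  congrFun (coe_basisOfLinearIndependentOfCardEqFinrank' _ _ _) i

/-- For `I ∈ Σ⁽ⁿ⁾`, the dual basis `(u_i^I)_{i ∈ I}` of `V*`. -/
def dualVec (Δ : SimplicialMultiFan V ι) (I : Δ.facets) (i : I.1) : Module.Dual ℝ V :=
  (Δ.facetBasis I).coord i

theorem dualVec_edge (Δ : SimplicialMultiFan V ι) (I : Δ.facets) (i j : I.1) :
    Δ.dualVec I i (Δ.edge j) = if i = j then 1 else 0 := by
  rw [← Δ.facetBasis_apply I j, dualVec, Module.Basis.coord_apply, Module.Basis.repr_self, Finsupp.single_apply]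
  simp [eq_comm]

end SimplicialMultiFan

/-- `x` is a primitive vector of the lattice `N`. -/
def IsPrimitiveVector {V : Type*} [AddCommGroup V] (N : Submodule ℤ V) (x : V) : Prop :=
  x ∈ N ∧ x ≠ 0 ∧ ∀ (a : ℤ), ∀ y ∈ N, x = a • y → a = 1 ∨ a = -1

/-- `N* = Hom(N, ℤ)`, as a subset of `V* = Hom(V, ℝ)`. -/
def dualLattice {V : Type*} [AddCommGroup V] [Module ℝ V] (N : Submodule ℤ V) :
    Set (Module.Dual ℝ V) :=
  {u | ∀ x ∈ N, ∃ m : ℤ, u x = m}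

/-- A simple multi-polytope `(Δ, F)`: a complete simplicial multi-fan `Δ` whose one-dimensional
cones `C({i})` are spanned by primitive vectors `v_i` of the lattice `N`, with the
affine hyperplanes `F({i}) = {u ∈ V* | ⟨u, v_i⟩ = c_i}`. -/
structure SimpleMultiPolytope {V : Type*} [AddCommGroup V] [Module ℝ V] [FiniteDimensional ℝ V]
    (N : Submodule ℤ V) (ι : Type*) [DecidableEq ι] where
  /-- the multi-fan `Δ` -/
  fan : SimplicialMultiFan V ι
  complete : fan.IsComplete
  primitive : ∀ i, {i} ∈ fan.simplices → IsPrimitiveVector N (fan.edge i)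
  /-- the constants `c_i` -/
  offset : ι → ℝ

namespace SimpleMultiPolytope

variable {V : Type*} [AddCommGroup V] [Module ℝ V] [FiniteDimensional ℝ V]
  {N : Submodule ℤ V} {ι : Type*} [DecidableEq ι]

/-- The affine hyperplane `F({i})`. -/
def hyperplane (P : SimpleMultiPolytope N ι) (i : ι) : Set (Module.Dual ℝ V) :=
  {u | u (P.fan.edge i) = P.offset i}

/-- For `I ∈ Σ⁽ⁿ⁾`, the vertex `u_I`, i.e. the common point of the hyperplanes `F({i})`,
`i ∈ I` (see `mem_hyperplanes_iff`). -/
def vertex (P : SimpleMultiPolytope N ι) (I : P.fan.facets) : Module.Dual ℝ V :=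
  ∑ i : I.1, P.offset i • P.fan.dualVec I i

theorem mem_hyperplanes_iff (P : SimpleMultiPolytope N ι) (I : P.fan.facets)
    (u : Module.Dual ℝ V) : (∀ i : I.1, u ∈ P.hyperplane i) ↔ u = P.vertex I := by
  have key : ∀ i : I.1, P.vertex I (P.fan.edge i) = P.offset i := by
    intro i
    simp [vertex, SimplicialMultiFan.dualVec_edge]
  constructor
  · intro h
    refine (P.fan.facetBasis I).ext fun i => ?_
    rw [P.fan.facetBasis_apply, key i]
    exact h i
  · rintro rfl i
    exact key i

/-- All vertices `u_I`, `I ∈ Σ⁽ⁿ⁾`, lie in `N*`. -/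
def IsLattice (P : SimpleMultiPolytope N ι) : Prop :=
  ∀ I : P.fan.facets, P.vertex I ∈ dualLattice N

/-- `(u_i^I)⁺`, which is `u_i^I` or `-u_i^I`, whichever is positive on the generic vector `v`. -/
def posDualVec (P : SimpleMultiPolytope N ι) (v : V) (I : P.fan.facets) (i : I.1) :
    Module.Dual ℝ V :=
  if 0 < P.fan.dualVec I i v then P.fan.dualVec I i else -P.fan.dualVec I i

/-- `(-1)^I`, the exponent being the number of `i ∈ I` with `⟨u_i^I, v⟩ > 0`. -/
def facetSign (P : SimpleMultiPolytope N ι) (v : V) (I : P.fan.facets) : ℤ :=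
  (-1) ^ (Finset.univ.filter fun i : I.1 => 0 < P.fan.dualVec I i v).card

/-- The cone `C*(I)⁺` with apex `u_I` spanned by the `(u_i^I)⁺`, `i ∈ I`. -/
def dualCone (P : SimpleMultiPolytope N ι) (v : V) (I : P.fan.facets) :
    Set (Module.Dual ℝ V) :=
  {u | ∃ r : I.1 → ℝ, (∀ i, 0 ≤ r i) ∧ u = P.vertex I + ∑ i, r i • P.posDualVec v I i}

/-- The Duistermaat-Heckman function `∑_I (-1)^I w(I) φ_I`, computed with the generic vector `v`.
It is only meant to be used off the hyperplanes `F({i})`. -/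
def dh (P : SimpleMultiPolytope N ι) (v : V) (u : Module.Dual ℝ V) : ℤ :=
  ∑ I : P.fan.facets,
    P.facetSign v I * P.fan.weight I.1 * (P.dualCone v I).indicator (fun _ => (1 : ℤ)) u

/-- `νP`: the constants `c_i` are replaced by `ν c_i`. -/
def scale (P : SimpleMultiPolytope N ι) (ν : ℤ) : SimpleMultiPolytope N ι :=
  { P with offset := fun i => (ν : ℝ) * P.offset i }

/-- Each `F({i})` is moved by `ε i` in the direction of `v_i`. -/
def shift (P : SimpleMultiPolytope N ι) (ε : ι → ℝ) : SimpleMultiPolytope N ι :=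
  { P with offset := fun i => P.offset i + ε i }

/-- The sum of the values of the Duistermaat-Heckman function over `N*` is a finite sum and is
equal to `k`, whichever generic vector is used to compute the function. -/
def HasLatticeSum (P : SimpleMultiPolytope N ι) (k : ℤ) : Prop :=
  ∀ v : V, P.fan.IsGeneric v →
    (dualLattice N ∩ Function.support (P.dh v)).Finite ∧ ∑ᶠ u ∈ dualLattice N, P.dh v u = k

/-- `♯(P) = k`, i.e. `k` is the sum over `N*` of the Duistermaat-Heckman function of `P₊`, for
every `P₊` obtained by moving each `F({i})` slightly in the direction of `v_i`. -/
def IsLatticeCount (P : SimpleMultiPolytope N ι) (k : ℤ) : Prop :=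
  ∀ᶠ ε in nhdsWithin (0 : ι → ℝ) {ε | ∀ i, 0 < ε i}, (P.shift ε).HasLatticeSum k

/-- `♯(P°) = k`, i.e. `k` is the sum over `N*` of the Duistermaat-Heckman function of `P₋`, for
every `P₋` obtained by moving each `F({i})` slightly in the direction of `-v_i`. -/
def IsInteriorLatticeCount (P : SimpleMultiPolytope N ι) (k : ℤ) : Prop :=
  ∀ᶠ ε in nhdsWithin (0 : ι → ℝ) {ε | ∀ i, 0 < ε i}, (P.shift (-ε)).HasLatticeSum k

/-- `vol(P) = a`: the Duistermaat-Heckman function is integrable with integral `a`, whichever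
generic vector is used to compute it.  Points of `V*` are written in the coordinates dual to the
basis `b` of `V`; if `b` is a basis of the lattice `N`, the unit cube of `N*` has volume one. -/
def IsVolume {n : ℕ} (b : Module.Basis (Fin n) ℝ V) (P : SimpleMultiPolytope N ι) (a : ℝ) : Prop :=
  ∀ v : V, P.fan.IsGeneric v →
    MeasureTheory.Integrable (fun x : Fin n → ℝ => (P.dh v (∑ j, x j • b.coord j) : ℝ)) ∧
      ∫ x : Fin n → ℝ, (P.dh v (∑ j, x j • b.coord j) : ℝ) = a

end SimpleMultiPolytope

end

/-! Off the hyperplanes, the sign and the cone of a facet I combine into a product of factors χ_i(u)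
- [⟨u_i^I, v⟩ > 0], where χ_i(u) = [⟨u, v_i⟩ ≤ c_i]. So DH is the function `wallSum`
(`dh_eq_wallSum`), and `wallSum` also gives it meaning on the hyperplanes.

Expanding the products, the coefficient of ∏_{i ∈ K} χ_i is, up to sign, the degree of the projected
multi-fan Δ_K at the image of v. Completeness therefore makes `wallSum` independent of v
(`IsComplete.wallSum_eq`). This freedom to change v gives compact support: a nonzero value at u puts
some vertex at most as high as u in any chosen generic direction, and opposite directions give
two-sided bounds. For a lattice multi-polytope, displacements smaller than 1 only select ≤ or < on
the hyperplanes, so the counts become `closedCount` and `openCount`. Replacing u, v, χ by -u, -v, 1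
- χ yields reciprocity.

For polynomiality, the contribution of I to νP is a fixed function ψ_I translated by ν u_I. A
product of difference operators, common to all facets, makes every ψ_I finitely supported. Summation
by parts against a polynomial in ⟨u, v⟩ whose differences equal 1 turns the count into finite sums
in which ν enters only through polynomial arguments (`exists_polynomial_finsum_eq`).

The degree bound and the leading coefficient come from Riemann sums: `closedCount` at k, divided by
k^n, tends to the volume. At ν = 0 only the origin contributes, and its value is the degree. -/

noncomputable section

/-! ### Wall sums: independence of the generic vector, symmetry, bounded support. -/

namespace SimplicialMultiFan

variable {V : Type*} [AddCommGroup V] [Module ℝ V] [FiniteDimensional ℝ V]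
  {ι : Type*} [DecidableEq ι]

/-- The coordinate of `v` along `edge i` in the basis `(edge i)_{i ∈ I}` of a facet `I`, and zero
if `I` is not a facet or `i ∉ I`. -/
def coordAt (Δ : SimplicialMultiFan V ι) (v : V) (I : Finset ι) (i : ι) : ℝ :=
  if h : I ∈ Δ.facets ∧ i ∈ I then Δ.dualVec ⟨I, h.1⟩ ⟨i, h.2⟩ v else 0

theorem coordAt_coe (Δ : SimplicialMultiFan V ι) (v : V) (I : Δ.facets) (i : I.1) :
    Δ.coordAt v I i = Δ.dualVec I i v := by
  simp [coordAt]

theorem sum_coordAt (Δ : SimplicialMultiFan V ι) (v : V) {I : Finset ι} (hI : I ∈ Δ.facets) :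
    ∑ i ∈ I, Δ.coordAt v I i • Δ.edge i = v := by
  rw [← Finset.sum_coe_sort]
  refine Eq.trans (Finset.sum_congr rfl fun i _ => ?_) ((Δ.facetBasis ⟨I, hI⟩).sum_repr v)
  rw [Δ.facetBasis_apply ⟨I, hI⟩ i, Δ.coordAt_coe v ⟨I, hI⟩ i]
  rfl

theorem coordAt_eq_of_eq_sum (Δ : SimplicialMultiFan V ι) {v : V} {I : Finset ι}
    (hI : I ∈ Δ.facets) {r : ι → ℝ} (h : v = ∑ i ∈ I, r i • Δ.edge i) {i : ι} (hi : i ∈ I) :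
    Δ.coordAt v I i = r i := by
  have key : Δ.dualVec ⟨I, hI⟩ ⟨i, hi⟩ v = r i := by
    rw [h, ← Finset.sum_coe_sort]
    simp only [map_sum, map_smul]
    rw [Finset.sum_eq_single (⟨i, hi⟩ : I)]
    · rw [Δ.dualVec_edge ⟨I, hI⟩ ⟨i, hi⟩ ⟨i, hi⟩]; simp
    · intro j _ hj
      rw [Δ.dualVec_edge ⟨I, hI⟩ ⟨i, hi⟩ j, if_neg hj.symm]; simp
    · simp
  rw [← key, ← Δ.coordAt_coe v ⟨I, hI⟩ ⟨i, hi⟩]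

theorem coordAt_neg (Δ : SimplicialMultiFan V ι) (v : V) (I : Finset ι) (i : ι) :
    Δ.coordAt (-v) I i = -Δ.coordAt v I i := by
  unfold coordAt
  split_ifs <;> simp

theorem IsGeneric.neg {Δ : SimplicialMultiFan V ι} {v : V} (hv : Δ.IsGeneric v) :
    Δ.IsGeneric (-v) :=
  fun I hI hlt h => hv I hI hlt (by simpa using h)

theorem mem_simplices_of_mem_facets {Δ : SimplicialMultiFan V ι} {I : Finset ι}
    (hI : I ∈ Δ.facets) : I ∈ Δ.simplices :=
  (Finset.mem_filter.1 hI).1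

theorem card_of_mem_facets {Δ : SimplicialMultiFan V ι} {I : Finset ι}
    (hI : I ∈ Δ.facets) : I.card = Module.finrank ℝ V :=
  (Finset.mem_filter.1 hI).2

theorem IsGeneric.coordAt_ne_zero {Δ : SimplicialMultiFan V ι} {v : V} (hv : Δ.IsGeneric v)
    {I : Finset ι} (hI : I ∈ Δ.facets) {i : ι} (hi : i ∈ I) : Δ.coordAt v I i ≠ 0 := by
  intro h0
  refine hv (I.erase i) (Δ.down_closed I (mem_simplices_of_mem_facets hI) _ (I.erase_subset i)) ?_ ?_
  · rw [← card_of_mem_facets hI]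
    exact Finset.card_erase_lt_of_mem hi
  · rw [← Δ.sum_coordAt v hI, ← Finset.add_sum_erase _ _ hi, h0, zero_smul, zero_add]
    exact Submodule.sum_mem _ fun j hj =>
      Submodule.smul_mem _ _ (Submodule.subset_span ⟨j, hj, rfl⟩)

/-- The polynomial `∑_I w(I) ∏_{i ∈ I} (χ_i - [v has positive i-th coordinate])`, through which
the Duistermaat-Heckman function is expressed. -/
def wallSum (Δ : SimplicialMultiFan V ι) (v : V) (χ : ι → ℤ) : ℤ :=
  ∑ I ∈ Δ.facets, Δ.weight I * ∏ i ∈ I, (χ i - if 0 < Δ.coordAt v I i then 1 else 0)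

/-- The preimage in V of the span of the projected cone of J is the span of C(J ∪ K), still a proper
subspace of the kind that v avoids. -/
theorem IsGeneric.proj {Δ : SimplicialMultiFan V ι} {v : V} (hv : Δ.IsGeneric v)
    {K : Finset ι} (hK : K ∈ Δ.simplices) :
    (Δ.proj K hK).IsGeneric ((Δ.coneSpan K).mkQ v) := by
  intro J hJ hlt hmem
  obtain ⟨_, h2, h3⟩ := Finset.mem_filter.1 hJ
  have h := (Δ.coneSpan K).finrank_quotient_add_finrank
  rw [Δ.finrank_coneSpan hK] at h
  refine hv (J ∪ K) h3 ?_ ?_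
  · rw [Finset.card_union_of_disjoint h2]; omega
  · have : (Δ.proj K hK).edge '' (J : Set ι) = (Δ.coneSpan K).mkQ '' (Δ.edge '' (J : Set ι)) := by
      rw [Set.image_image]; rfl
    rw [this, Submodule.span_image, ← Submodule.mem_comap, Submodule.comap_map_mkQ] at hmem
    rw [Finset.coe_union, Set.image_union, Submodule.span_union, sup_comm]
    exact hmem

/-- Passing to the quotient by the span of C(K) forgets exactly the coordinates indexed by K. -/
theorem mkQ_mem_proj_cone (Δ : SimplicialMultiFan V ι) (v : V) {K : Finset ι}
    (hK : K ∈ Δ.simplices) {I : Finset ι} (hI : I ∈ Δ.facets) (hKI : K ⊆ I) :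
    (Δ.coneSpan K).mkQ v ∈ (Δ.proj K hK).cone (I \ K) ↔ ∀ i ∈ I \ K, 0 ≤ Δ.coordAt v I i := by
  constructor
  · rintro ⟨r, hr, hv⟩ i hi
    have hmem : v - ∑ i ∈ I \ K, r i • Δ.edge i ∈ Δ.coneSpan K := by
      rw [← Submodule.Quotient.mk_eq_zero, Submodule.Quotient.mk_sub, sub_eq_zero]
      refine hv.trans ?_
      change _ = (Δ.coneSpan K).mkQ _
      rw [map_sum]
      rfl
    rw [Submodule.mem_span_image_finset_iff_exists_fun] at hmem
    obtain ⟨s', hs'⟩ := hmem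
    obtain ⟨s, hs⟩ : ∃ s : ι → ℝ, ∑ i ∈ K, s i • Δ.edge i = v - ∑ i ∈ I \ K, r i • Δ.edge i :=
      ⟨fun i => if h : i ∈ K then s' ⟨i, h⟩ else 0, by
        rw [← hs', ← Finset.sum_coe_sort]
        exact Finset.sum_congr rfl fun i _ => by simp⟩
    have hv' : v = ∑ i ∈ I, (if i ∈ K then s i else r i) • Δ.edge i := by
      rw [← Finset.sum_sdiff hKI]
      rw [Finset.sum_congr rfl (g := fun i => r i • Δ.edge i) (s₁ := I \ K)
          (fun i hi => by rw [if_neg (Finset.mem_sdiff.1 hi).2]),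
        Finset.sum_congr rfl (g := fun i => s i • Δ.edge i) (s₁ := K)
          (fun i hi => by rw [if_pos hi]), hs]
      abel
    obtain ⟨h1, h2⟩ := Finset.mem_sdiff.1 hi
    rw [Δ.coordAt_eq_of_eq_sum hI hv' h1, if_neg h2]
    exact hr i hi
  · intro h
    refine ⟨Δ.coordAt v I, h, ?_⟩
    have hv := Δ.sum_coordAt v hI
    rw [← Finset.sum_sdiff hKI] at hv
    have h0 : (Δ.coneSpan K).mkQ (∑ i ∈ K, Δ.coordAt v I i • Δ.edge i) = 0 :=
      (Submodule.Quotient.mk_eq_zero _).2 (Submodule.sum_mem _ fun j hj =>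
        Submodule.smul_mem _ _ (Submodule.subset_span ⟨j, hj, rfl⟩))
    have h1 := congrArg (Δ.coneSpan K).mkQ hv
    rw [map_add, h0, add_zero, map_sum] at h1
    exact h1.symm

theorem degreeAt_proj {Δ : SimplicialMultiFan V ι} {v : V} (hv : Δ.IsGeneric v) {K : Finset ι}
    (hK : K ∈ Δ.simplices) :
    (Δ.proj K hK).degreeAt ((Δ.coneSpan K).mkQ v) = ∑ I ∈ Δ.facets with K ⊆ I,
      Δ.weight I * ∏ i ∈ I \ K, if 0 < Δ.coordAt v I i then 1 else 0 := by
  classical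
  have hfin := (Δ.coneSpan K).finrank_quotient_add_finrank
  rw [Δ.finrank_coneSpan hK] at hfin
  rw [degreeAt, Finset.sum_filter]
  symm
  refine Finset.sum_bij' (fun I _ => I \ K) (fun J _ => J ∪ K) ?_ ?_ ?_ ?_ ?_
  · intro I hI
    obtain ⟨hI, hKI⟩ := Finset.mem_filter.1 hI
    have hs := mem_simplices_of_mem_facets hI
    refine Finset.mem_filter.2 ⟨Finset.mem_filter.2
      ⟨Δ.down_closed _ hs _ Finset.sdiff_subset, Finset.sdiff_disjoint, ?_⟩, ?_⟩
    · rwa [Finset.sdiff_union_of_subset hKI]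
    · have := card_of_mem_facets hI
      rw [Finset.card_sdiff_of_subset hKI]; omega
  · intro J hJ
    obtain ⟨hJ, hc⟩ := Finset.mem_filter.1 hJ
    obtain ⟨_, h2, h3⟩ := Finset.mem_filter.1 hJ
    refine Finset.mem_filter.2 ⟨Finset.mem_filter.2 ⟨h3, ?_⟩, Finset.subset_union_right⟩
    rw [Finset.card_union_of_disjoint h2]; omega
  · intro I hI
    exact Finset.sdiff_union_of_subset (Finset.mem_filter.1 hI).2
  · intro J hJ
    obtain ⟨hJ, hc⟩ := Finset.mem_filter.1 hJ
    obtain ⟨_, h2, h3⟩ := Finset.mem_filter.1 hJ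
    exact Finset.union_sdiff_cancel_right h2
  · intro I hI
    obtain ⟨hI, hKI⟩ := Finset.mem_filter.1 hI
    have hw : (Δ.proj K hK).weight (I \ K) = Δ.weight I := by
      simp only [weight, SimplicialMultiFan.proj, Finset.sdiff_union_of_subset hKI]
    have hiff : (∀ i ∈ I \ K, 0 < Δ.coordAt v I i) ↔ ∀ i ∈ I \ K, 0 ≤ Δ.coordAt v I i :=
      forall₂_congr fun i hi => ⟨le_of_lt, fun h => lt_of_le_of_ne h
        (hv.coordAt_ne_zero hI (Finset.mem_sdiff.1 hi).1).symm⟩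
    rw [hw, Finset.prod_ite_zero, mkQ_mem_proj_cone Δ v hK hI hKI, ← hiff]
    simp

/-- Expand each product over the subsets K of I and exchange the sums: the facets containing K
assemble into the degree of Δ_K. All dependence on v thus sits in degrees, which completeness makes
constant. -/
theorem wallSum_eq_sum_degreeAt {Δ : SimplicialMultiFan V ι} {v : V} (hv : Δ.IsGeneric v)
    (χ : ι → ℤ) :
    Δ.wallSum v χ = ∑ K : Δ.simplices, (∏ i ∈ K.1, χ i) * (-1) ^ (Module.finrank ℝ V - K.1.card) *
      (Δ.proj K.1 K.2).degreeAt ((Δ.coneSpan K.1).mkQ v) := by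
  have h1 : Δ.wallSum v χ = ∑ I ∈ Δ.facets, ∑ K ∈ Δ.simplices with K ⊆ I,
      (∏ i ∈ K, χ i) * (-1) ^ (Module.finrank ℝ V - K.card) *
        (Δ.weight I * ∏ i ∈ I \ K, if 0 < Δ.coordAt v I i then 1 else 0) := by
    refine Finset.sum_congr rfl fun I hI => ?_
    have hset : (Δ.simplices.filter fun K => K ⊆ I) = I.powerset := by
      ext K
      rw [Finset.mem_filter, Finset.mem_powerset]
      exact ⟨And.right, fun h => ⟨Δ.down_closed I (mem_simplices_of_mem_facets hI) K h, h⟩⟩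
    simp_rw [sub_eq_add_neg]
    rw [Finset.prod_add, Finset.mul_sum, hset]
    refine Finset.sum_congr rfl fun K hK => ?_
    rw [Finset.prod_neg, Finset.card_sdiff_of_subset (Finset.mem_powerset.1 hK),
      card_of_mem_facets hI]
    ring
  rw [h1]
  simp_rw [Finset.sum_filter]
  rw [Finset.sum_comm, ← Finset.sum_coe_sort]
  refine Finset.sum_congr rfl fun K _ => ?_
  rw [degreeAt_proj hv K.2, ← Finset.sum_filter, Finset.mul_sum]

theorem IsComplete.wallSum_eq {Δ : SimplicialMultiFan V ι} (hΔ : Δ.IsComplete) {v v' : V}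
    (hv : Δ.IsGeneric v) (hv' : Δ.IsGeneric v') (χ : ι → ℤ) :
    Δ.wallSum v χ = Δ.wallSum v' χ := by
  rw [wallSum_eq_sum_degreeAt hv, wallSum_eq_sum_degreeAt hv']
  exact Finset.sum_congr rfl fun K _ => by
    rw [(hΔ.2 K.1 K.2).2 _ _ (hv.proj K.2) (hv'.proj K.2)]

theorem mem_cone_iff_coordAt (Δ : SimplicialMultiFan V ι) (v : V) {I : Finset ι}
    (hI : I ∈ Δ.facets) : v ∈ Δ.cone I ↔ ∀ i ∈ I, 0 ≤ Δ.coordAt v I i := by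
  constructor
  · rintro ⟨r, hr, h⟩ i hi
    rw [Δ.coordAt_eq_of_eq_sum hI h hi]
    exact hr i hi
  · intro h
    exact ⟨Δ.coordAt v I, h, (Δ.sum_coordAt v hI).symm⟩

/-- At `χ = 1` the sum is the degree at `-v`. -/
theorem wallSum_one {Δ : SimplicialMultiFan V ι} {v : V} (hv : Δ.IsGeneric v) :
    Δ.wallSum v (fun _ => 1) = Δ.degreeAt (-v) := by
  classical
  rw [degreeAt, Finset.sum_filter]
  refine Finset.sum_congr rfl fun I hI => ?_
  have h1 : ∀ i ∈ I, (1 - if 0 < Δ.coordAt v I i then 1 else 0 : ℤ) =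
      if 0 ≤ Δ.coordAt (-v) I i then 1 else 0 := by
    intro i hi
    have := hv.coordAt_ne_zero hI hi
    rw [coordAt_neg]
    rcases lt_or_gt_of_ne this with h | h
    · rw [if_neg h.not_gt, if_pos (by linarith)]; rfl
    · rw [if_pos h, if_neg (by linarith)]; rfl
  rw [Finset.prod_congr rfl h1, Finset.prod_ite_zero, Δ.mem_cone_iff_coordAt _ hI]
  simp

/-- Reversing both `v` and `χ` multiplies the sum by `(-1)^n`. -/
theorem wallSum_neg {Δ : SimplicialMultiFan V ι} {v : V} (hv : Δ.IsGeneric v) (χ : ι → ℤ) :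
    Δ.wallSum (-v) (fun i => 1 - χ i) = (-1) ^ Module.finrank ℝ V * Δ.wallSum v χ := by
  rw [wallSum, wallSum, Finset.mul_sum]
  refine Finset.sum_congr rfl fun I hI => ?_
  have h1 : ∀ i ∈ I, ((1 - χ i) - if 0 < Δ.coordAt (-v) I i then 1 else 0 : ℤ) =
      -(χ i - if 0 < Δ.coordAt v I i then 1 else 0) := by
    intro i hi
    have := hv.coordAt_ne_zero hI hi
    rw [coordAt_neg]
    rcases lt_or_gt_of_ne this with h | h
    · rw [if_neg h.not_gt, if_pos (by linarith)]; ring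
    · rw [if_pos h, if_neg (by linarith)]; ring
  rw [Finset.prod_congr rfl h1, Finset.prod_neg, card_of_mem_facets hI]
  ring

/-- Needed because the offsets are known to be integers only at indices belonging to facets. -/
theorem wallSum_congr (Δ : SimplicialMultiFan V ι) (v : V) {χ χ' : ι → ℤ}
    (h : ∀ I ∈ Δ.facets, ∀ i ∈ I, χ i = χ' i) : Δ.wallSum v χ = Δ.wallSum v χ' :=
  Finset.sum_congr rfl fun I hI => by
    rw [Finset.prod_congr rfl fun i hi => by rw [h I hI i hi]]

/-- If the sum is nonzero and `χ` records on which side of the hyperplanes `⟨u, edge i⟩ = c i` a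
point `u` lies, then one of the vertices has at most the height of `u` in the direction `v`. -/
theorem exists_vertex_le_of_wallSum_ne_zero {Δ : SimplicialMultiFan V ι} {v : V} {χ : ι → ℤ}
    {u : Module.Dual ℝ V} {c : ι → ℝ}
    (hχ : ∀ i, (χ i = 1 ∧ u (Δ.edge i) ≤ c i) ∨ (χ i = 0 ∧ c i ≤ u (Δ.edge i)))
    (h : Δ.wallSum v χ ≠ 0) :
    ∃ I ∈ Δ.facets, ∑ i ∈ I, Δ.coordAt v I i * c i ≤ u v := by
  obtain ⟨I, hI, hne⟩ := Finset.exists_ne_zero_of_sum_ne_zero h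
  refine ⟨I, hI, ?_⟩
  -- A nonzero factor forces χ i = 0 where the coordinate of v is positive and χ i = 1 elsewhere. In
  -- both cases coordinate times c i is at most coordinate times u (edge i).
  have hprod := Finset.prod_ne_zero_iff.1 (right_ne_zero_of_mul hne)
  conv_rhs => rw [← Δ.sum_coordAt v hI]
  rw [map_sum]
  refine Finset.sum_le_sum fun i hi => ?_
  rw [map_smul, smul_eq_mul]
  have := hprod i hi
  rcases hχ i with ⟨h1, h2⟩ | ⟨h1, h2⟩
  · by_cases h3 : 0 < Δ.coordAt v I i
    · simp [h1, h3] at this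
    · exact mul_le_mul_of_nonpos_left h2 (not_lt.1 h3)
  · by_cases h3 : 0 < Δ.coordAt v I i
    · exact mul_le_mul_of_nonneg_left h2 h3.le
    · simp [h1, h3] at this

/-- A proper subspace misses some generic vector. -/
theorem exists_isGeneric_notMem (Δ : SimplicialMultiFan V ι) {W : Submodule ℝ V} (hW : W ≠ ⊤) :
    ∃ v, Δ.IsGeneric v ∧ v ∉ W := by
  classical
  let s : Finset (Submodule ℝ V) :=
    insert W ((Δ.simplices.filter fun I => I.card < Module.finrank ℝ V).image
      fun I : Finset ι => Submodule.span ℝ (Δ.edge '' (I : Set ι)))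
  have hs : ⊤ ∉ s := by
    intro h
    rcases Finset.mem_insert.1 h with h | h
    · exact hW h.symm
    obtain ⟨I, hI, hI'⟩ := Finset.mem_image.1 h
    have hlt := (Finset.mem_filter.1 hI).2
    have hle := Δ.finrank_coneSpan (Finset.mem_filter.1 hI).1
    rw [coneSpan, hI', finrank_top] at hle
    omega
  obtain ⟨v, hv⟩ := (Set.ne_univ_iff_exists_notMem _).1 (Subspace.biUnion_ne_univ_of_top_notMem hs)
  refine ⟨v, fun I hI hlt hmem => hv ?_, fun hmem => hv ?_⟩
  · exact Set.mem_biUnion (Finset.mem_insert_of_mem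
      (Finset.mem_image.2 ⟨I, Finset.mem_filter.2 ⟨hI, hlt⟩, rfl⟩)) hmem
  · exact Set.mem_biUnion (Finset.mem_insert_self _ _) hmem

theorem degree_eq_degreeAt {Δ : SimplicialMultiFan V ι} (hΔ : Δ.IsComplete) {v : V}
    (hv : Δ.IsGeneric v) : Δ.degree = Δ.degreeAt v :=
  hΔ.1.2 _ _ (Classical.choose_spec Δ.exists_isGeneric) hv

/-- The points `u` at which the sum is nonzero are bounded in every direction. -/
theorem IsComplete.bounded_of_wallSum_ne_zero {Δ : SimplicialMultiFan V ι} (hΔ : Δ.IsComplete)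
    (c : ι → ℝ) (y : V) :
    ∃ R : ℝ, ∀ (u : Module.Dual ℝ V) (χ : ι → ℤ) (v : V), Δ.IsGeneric v →
      (∀ i, (χ i = 1 ∧ u (Δ.edge i) ≤ c i) ∨ (χ i = 0 ∧ c i ≤ u (Δ.edge i))) →
      Δ.wallSum v χ ≠ 0 → |u y| ≤ R := by
  -- The directions in which u stays bounded form a subspace. It contains every generic vector,
  -- hence is everything.
  let W : Submodule ℝ V :=
    { carrier := {y | ∃ R : ℝ, ∀ (u : Module.Dual ℝ V) (χ : ι → ℤ) (v : V), Δ.IsGeneric v →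
        (∀ i, (χ i = 1 ∧ u (Δ.edge i) ≤ c i) ∨ (χ i = 0 ∧ c i ≤ u (Δ.edge i))) →
        Δ.wallSum v χ ≠ 0 → |u y| ≤ R}
      add_mem' := by
        rintro y z ⟨R, hR⟩ ⟨S, hS⟩
        refine ⟨R + S, fun u χ v hv h hne => ?_⟩
        rw [map_add]
        exact (abs_add_le _ _).trans (add_le_add (hR u χ v hv h hne) (hS u χ v hv h hne))
      zero_mem' := ⟨0, fun u χ v _ _ _ => by simp⟩
      smul_mem' := by
        rintro a y ⟨R, hR⟩
        refine ⟨|a| * R, fun u χ v hv h hne => ?_⟩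
        rw [map_smul, smul_eq_mul, abs_mul]
        exact mul_le_mul_of_nonneg_left (hR u χ v hv h hne) (abs_nonneg a) }
  have hgen : ∀ g, Δ.IsGeneric g → g ∈ W := by
    intro g hg
    refine ⟨∑ I ∈ Δ.facets, |∑ i ∈ I, Δ.coordAt g I i * c i|, fun u χ v hv h hne => ?_⟩
    have hle : ∀ I ∈ Δ.facets, |∑ i ∈ I, Δ.coordAt g I i * c i| ≤
        ∑ I ∈ Δ.facets, |∑ i ∈ I, Δ.coordAt g I i * c i| := fun I hI =>
      Finset.single_le_sum (f := fun I => |∑ i ∈ I, Δ.coordAt g I i * c i|)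
        (fun _ _ => abs_nonneg _) hI
    -- The sum does not change when v is replaced by g or by -g; these give the lower and the upper
    -- bound for u g.
    obtain ⟨I, hI, h1⟩ := exists_vertex_le_of_wallSum_ne_zero (v := g) h
      (by rwa [hΔ.wallSum_eq hg hv])
    obtain ⟨J, hJ, h2⟩ := exists_vertex_le_of_wallSum_ne_zero (v := -g) h
      (by rwa [hΔ.wallSum_eq hg.neg hv])
    simp only [coordAt_neg, neg_mul, Finset.sum_neg_distrib, map_neg, neg_le_neg_iff] at h2
    exact abs_le.2 ⟨(neg_le_neg (hle I hI)).trans ((neg_abs_le _).trans h1),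
      (h2.trans (le_abs_self _)).trans (hle J hJ)⟩
  have htop : W = ⊤ := by
    by_contra hW
    obtain ⟨g, hg, hgW⟩ := Δ.exists_isGeneric_notMem hW
    exact hgW (hgen g hg)
  have : y ∈ W := htop ▸ Submodule.mem_top
  exact this

end SimplicialMultiFan

/-! ### Difference operators and polynomiality of sums of translates. -/

section TranslationDiff

variable {L : Type*} [AddCommGroup L]

/-- The difference operator `f ↦ f - f (· - w)`. -/
def translationDiff (w : L) (f : L → ℝ) : L → ℝ := fun u => f u - f (u - w)

instance : LeftCommutative (translationDiff (L := L)) where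
  left_comm w w' f := by
    funext u
    simp only [translationDiff]
    rw [sub_right_comm u w w']
    ring

/-- The composition of the difference operators of the members of a multiset. -/
def translationDiffs (s : Multiset L) (f : L → ℝ) : L → ℝ := s.foldr translationDiff f

@[simp]
theorem translationDiffs_zero (f : L → ℝ) : translationDiffs 0 f = f := rfl

@[simp]
theorem translationDiffs_cons (w : L) (s : Multiset L) (f : L → ℝ) :
    translationDiffs (w ::ₘ s) f = translationDiff w (translationDiffs s f) :=
  Multiset.foldr_cons _ _ _ _

theorem translationDiffs_add (s t : Multiset L) (f : L → ℝ) :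
    translationDiffs (s + t) f = translationDiffs s (translationDiffs t f) :=
  Multiset.foldr_add _ _ _ _

theorem finite_support_comp_sub {f : L → ℝ} (hf : f.support.Finite) (p : L) :
    (Function.support fun u => f (u - p)).Finite :=
  hf.preimage (f := fun u => u - p) (sub_left_injective.injOn)

theorem finite_support_translationDiff {f : L → ℝ} (hf : f.support.Finite) (w : L) :
    (translationDiff w f).support.Finite :=
  (hf.union (finite_support_comp_sub hf w)).subset (Function.support_sub _ _)

theorem finite_support_translationDiffs {f : L → ℝ} (hf : f.support.Finite) (s : Multiset L) :
    (translationDiffs s f).support.Finite := by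
  induction s using Multiset.induction with
  | empty => exact hf
  | cons w s ih => rw [translationDiffs_cons]; exact finite_support_translationDiff ih w

theorem translationDiffs_sum {α : Type*} (A : Finset α) (f : α → L → ℝ) (s : Multiset L) :
    translationDiffs s (fun u => ∑ a ∈ A, f a u) =
      fun u => ∑ a ∈ A, translationDiffs s (f a) u := by
  induction s using Multiset.induction with
  | empty => rfl
  | cons w s ih =>
    simp only [translationDiffs_cons, ih]
    funext u
    simp only [translationDiff, Finset.sum_sub_distrib]

theorem translationDiffs_const_mul (c : ℝ) (f : L → ℝ) (s : Multiset L) :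
    translationDiffs s (fun u => c * f u) = fun u => c * translationDiffs s f u := by
  induction s using Multiset.induction with
  | empty => rfl
  | cons w s ih =>
    simp only [translationDiffs_cons, ih]
    funext u
    simp only [translationDiff, mul_sub]

theorem translationDiffs_comp_sub (f : L → ℝ) (p : L) (s : Multiset L) :
    translationDiffs s (fun u => f (u - p)) = fun u => translationDiffs s f (u - p) := by
  induction s using Multiset.induction with
  | empty => rfl
  | cons w s ih =>
    simp only [translationDiffs_cons, ih]
    funext u
    simp only [translationDiff, sub_right_comm]

theorem finsum_comp_sub (f : L → ℝ) (p : L) : ∑ᶠ u, f (u - p) = ∑ᶠ u, f u :=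
  finsum_comp_equiv (Equiv.subRight p)

theorem finite_support_mul {α : Type*} {f : α → ℝ} (hf : f.support.Finite) (g : α → ℝ) :
    (Function.support fun u => f u * g u).Finite :=
  hf.subset (Function.support_mul_subset_left _ _)

/-- Summation by parts. -/
theorem finsum_translationDiff_mul {f : L → ℝ} (hf : f.support.Finite) (g : L → ℝ) (w : L) :
    ∑ᶠ u, translationDiff w f u * g u = ∑ᶠ u, f u * translationDiff (-w) g u := by
  have h1 : ∑ᶠ u, f (u - w) * g u = ∑ᶠ u, f u * g (u - -w) := by
    rw [← finsum_comp_sub (fun u => f u * g (u - -w)) w]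
    simp
  simp only [translationDiff, sub_mul, mul_sub]
  rw [finsum_sub_distrib (finite_support_mul hf g)
      (finite_support_mul (finite_support_comp_sub hf w) g),
    finsum_sub_distrib (finite_support_mul hf g)
      (finite_support_mul hf fun u => g (u - -w)), h1]

theorem finsum_translationDiffs_mul {f : L → ℝ} (hf : f.support.Finite) (g : L → ℝ)
    (s : Multiset L) :
    ∑ᶠ u, translationDiffs s f u * g u =
      ∑ᶠ u, f u * translationDiffs (s.map fun w => -w) g u := by
  induction s using Multiset.induction generalizing g with
  | empty => rfl
  | cons w s ih =>
    rw [translationDiffs_cons,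
      finsum_translationDiff_mul (finite_support_translationDiffs hf s), ih, Multiset.map_cons,
      ← Multiset.singleton_add, add_comm, translationDiffs_add]
    rfl

open Polynomial in
/-- Difference operators on real polynomials are surjective. -/
theorem Polynomial.exists_sub_eval_sub_eq (Q : ℝ[X]) {t : ℝ} (ht : t ≠ 0) :
    ∃ G : ℝ[X], ∀ x, G.eval x - G.eval (x - t) = Q.eval x := by
  induction Q using Polynomial.induction_on' with
  | add P Q hP hQ =>
    obtain ⟨G, hG⟩ := hP
    obtain ⟨H, hH⟩ := hQ
    refine ⟨G + H, fun x => ?_⟩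
    rw [eval_add, eval_add, eval_add, ← hG, ← hH]
    ring
  | monomial k a =>
    -- Bernoulli polynomials solve the equation for unit step; substituting x / t rescales the step
    -- to t.
    let B : ℝ[X] := (bernoulli (k + 1)).map (algebraMap ℚ ℝ)
    have hB : ∀ y : ℝ, B.eval (1 + y) = B.eval y + (k + 1) * y ^ k := by
      intro y
      have h := congrArg (fun p : ℚ[X] => (p.map (algebraMap ℚ ℝ)).eval y)
        (bernoulli_comp_one_add_X (k + 1))
      simpa [Polynomial.map_comp, B] using h
    refine ⟨C (a * t ^ k / (k + 1)) * B.comp (1 + C t⁻¹ * X), fun x => ?_⟩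
    have hk : (k + 1 : ℝ) ≠ 0 := by positivity
    have h1 : 1 + t⁻¹ * (x - t) = t⁻¹ * x := by field_simp; ring
    simp only [eval_mul, eval_C, eval_comp, eval_add, eval_one, eval_X, eval_monomial, h1, hB,
      mul_pow, inv_pow]
    field_simp
    ring

open Polynomial in
theorem exists_translationDiffs_eval_eq (h : L →+ ℝ) (s : Multiset L) (hs : ∀ w ∈ s, h w ≠ 0)
    (Q : ℝ[X]) :
    ∃ G : ℝ[X], translationDiffs s (fun u => G.eval (h u)) = fun u => Q.eval (h u) := by
  induction s using Multiset.induction generalizing Q with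
  | empty => exact ⟨Q, rfl⟩
  | cons w s ih =>
    obtain ⟨G, hG⟩ := Q.exists_sub_eval_sub_eq (hs w (Multiset.mem_cons_self w s))
    obtain ⟨H, hH⟩ := ih (fun v hv => hs v (Multiset.mem_cons_of_mem hv)) G
    refine ⟨H, ?_⟩
    rw [translationDiffs_cons, hH]
    funext u
    simp only [translationDiff, map_sub, hG]

open Polynomial in
/-- The sum over a lattice of a combination of translated functions `ψ a (u - ν p_a)`, each of
which is annihilated up to finite support by a fixed composition of difference operators, is a
polynomial in `ν`. -/
theorem exists_polynomial_finsum_eq {α : Type*} (A : Finset α) (ψ : α → L → ℝ) (p : α → L)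
    (h : L →+ ℝ) (s : Multiset L) (hs : ∀ w ∈ s, h w ≠ 0)
    (hψ : ∀ a ∈ A, (translationDiffs s (ψ a)).support.Finite)
    (hF : ∀ ν : ℤ, (Function.support fun u => ∑ a ∈ A, ψ a (u - ν • p a)).Finite) :
    ∃ P : ℝ[X], ∀ ν : ℤ, P.eval (ν : ℝ) = ∑ᶠ u, ∑ a ∈ A, ψ a (u - ν • p a) := by
  classical
  -- All the opposite differences of G ∘ h together give the constant 1. Inserting this 1 in the sum
  -- and summing by parts moves the differences onto the functions ψ a.
  obtain ⟨G, hG⟩ := exists_translationDiffs_eval_eq h (s.map fun w => -w)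
    (by
      intro w hw
      obtain ⟨w', hw', rfl⟩ := Multiset.mem_map.1 hw
      rw [map_neg]
      exact neg_ne_zero.2 (hs w' hw')) 1
  refine ⟨∑ a ∈ A.attach, ∑ u ∈ (hψ a.1 a.2).toFinset,
    C (translationDiffs s (ψ a.1) u) * G.comp (C (h u) + C (h (p a.1)) * X), fun ν => ?_⟩
  have h1 : ∑ᶠ u, ∑ a ∈ A, ψ a (u - ν • p a) =
      ∑ᶠ u, ∑ a ∈ A, translationDiffs s (ψ a) (u - ν • p a) * G.eval (h u) := by
    have h2 := finsum_translationDiffs_mul (hF ν) (fun u => G.eval (h u)) s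
    rw [hG, translationDiffs_sum] at h2
    simp only [translationDiffs_comp_sub, eval_one, mul_one] at h2
    rw [← h2]
    simp only [Finset.sum_mul]
  rw [h1, finsum_sum_comm _ _ fun a ha =>
      finite_support_mul (finite_support_comp_sub (hψ a ha) _) _,
    eval_finsetSum, ← Finset.sum_attach A]
  refine Finset.sum_congr rfl fun a _ => ?_
  -- Recentring at ν p_a leaves ν only in the argument of G, over a support independent of ν.
  have h3 : ∑ᶠ u, translationDiffs s (ψ a.1) (u - ν • p a.1) * G.eval (h u) =
      ∑ᶠ u, translationDiffs s (ψ a.1) u * G.eval (h u + ν * h (p a.1)) := by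
    rw [← finsum_comp_sub (fun u => translationDiffs s (ψ a.1) u *
      G.eval (h u + ν * h (p a.1))) (ν • p a.1)]
    simp
  rw [h3, finsum_eq_sum_of_support_subset (s := (hψ a.1 a.2).toFinset) _
    (by
      rw [Set.Finite.coe_toFinset]
      exact Function.support_mul_subset_left _ _), eval_finsetSum]
  refine Finset.sum_congr rfl fun u _ => ?_
  simp only [eval_mul, eval_C, eval_comp, eval_add, eval_X]
  rw [mul_comm (ν : ℝ)]

/-- Difference operators in the coordinate directions act on the factors of a product. -/
theorem translationDiffs_prod {ι : Type*} [DecidableEq ι] (I : Finset ι) (x : ι → L →+ ℝ)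
    (w : ι → L) (m : ι → ℝ) (hw : ∀ i ∈ I, ∀ j ∈ I, x i (w j) = if i = j then m j else 0)
    (g : ι → ℝ → ℝ) {J : Finset ι} (hJ : J ⊆ I) :
    translationDiffs (J.val.map w) (fun u => ∏ i ∈ I, g i (x i u)) =
      fun u => ∏ i ∈ I, if i ∈ J then g i (x i u) - g i (x i u - m i) else g i (x i u) := by
  induction J using Finset.induction_on with
  | empty => simp
  | insert j J hj ih =>
    have hjI : j ∈ I := hJ (Finset.mem_insert_self _ _)
    rw [Finset.insert_val_of_notMem hj, Multiset.map_cons, translationDiffs_cons,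
      ih ((Finset.subset_insert _ _).trans hJ)]
    funext u
    simp only [translationDiff]
    -- Translation by w j moves only the j-th coordinate, so the other factors are common to both
    -- terms.
    rw [← Finset.mul_prod_erase I _ hjI, ← Finset.mul_prod_erase I _ hjI,
      ← Finset.mul_prod_erase I _ hjI, if_neg hj, if_neg hj, if_pos (Finset.mem_insert_self _ _),
      sub_mul, map_sub, hw j hjI j hjI, if_pos rfl]
    congr 1
    · congr 1
      refine Finset.prod_congr rfl fun i hi => ?_
      simp [Finset.mem_insert, (Finset.mem_erase.1 hi).1]
    · congr 1
      refine Finset.prod_congr rfl fun i hi => ?_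
      obtain ⟨hij, hiI⟩ := Finset.mem_erase.1 hi
      simp [Finset.mem_insert, hij, map_sub, hw i hiI j hjI]

end TranslationDiff

/-! ### The dual lattice. -/

/-- The dual lattice `N*` as a subgroup of `V*`. -/
def dualLatticeSubgroup {V : Type*} [AddCommGroup V] [Module ℝ V] (N : Submodule ℤ V) :
    AddSubgroup (Module.Dual ℝ V) where
  carrier := dualLattice N
  add_mem' := by
    intro u u' hu hu' x hx
    obtain ⟨m, hm⟩ := hu x hx
    obtain ⟨m', hm'⟩ := hu' x hx
    exact ⟨m + m', by simp [hm, hm']⟩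
  zero_mem' := fun x _ => ⟨0, by simp⟩
  neg_mem' := by
    intro u hu x hx
    obtain ⟨m, hm⟩ := hu x hx
    exact ⟨-m, by simp [hm]⟩

section Lattice

variable {V : Type*} [AddCommGroup V] [Module ℝ V] {N : Submodule ℤ V}

/-- Evaluation of the points of the dual lattice at a vector. -/
def evalDualLattice (N : Submodule ℤ V) (y : V) : dualLatticeSubgroup N →+ ℝ where
  toFun u := u.1 y
  map_zero' := rfl
  map_add' _ _ := rfl

@[simp]
theorem evalDualLattice_apply (y : V) (u : dualLatticeSubgroup N) :
    evalDualLattice N y u = u.1 y := rfl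

/-- A point of N* is determined by its values on B, which are integers in bounded intervals. -/
theorem finite_setOf_abs_le {κ : Type*} [Finite κ] (B : Module.Basis κ ℝ V) (hB : ∀ k, B k ∈ N)
    (R : κ → ℝ) : {u : dualLatticeSubgroup N | ∀ k, |u.1 (B k)| ≤ R k}.Finite := by
  have hfin : (Set.univ.pi fun k => Set.Icc (-⌈R k⌉) ⌈R k⌉ : Set (κ → ℤ)).Finite :=
    Set.Finite.pi fun k => Set.finite_Icc _ _
  choose f hf using fun (u : dualLatticeSubgroup N) (k : κ) => u.2 (B k) (hB k)
  refine Set.Finite.of_finite_image (f := f) (hfin.subset ?_) ?_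
  · rintro _ ⟨u, hu, rfl⟩ k _
    have h := abs_le.1 ((hu k).trans (Int.le_ceil _))
    rw [hf] at h
    exact ⟨by exact_mod_cast h.1, by exact_mod_cast h.2⟩
  · intro u _ u' _ h
    refine Subtype.ext (B.ext fun k => ?_)
    rw [hf, hf, h]

theorem exists_int_repr {κ : Type*} (b : Module.Basis κ ℝ V) {x : V}
    (hx : x ∈ Submodule.span ℤ (Set.range b)) (k : κ) : ∃ m : ℤ, b.repr x k = m := by
  obtain ⟨m, hm⟩ := (b.mem_span_iff_repr_mem ℤ x).1 hx k
  exact ⟨m, by simpa using hm.symm⟩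

/-- Any basis of `V` consisting of vectors of `N` has a multiple of its dual basis in `N*`. -/
theorem exists_multiple_dual_basis {κ κ' : Type*} [Fintype κ] [DecidableEq κ] [Finite κ']
    (b : Module.Basis κ' ℝ V) (hN : Submodule.span ℤ (Set.range b) = N)
    (B : Module.Basis κ ℝ V) (hB : ∀ k, B k ∈ N) :
    ∃ m : ℝ, m ≠ 0 ∧ ∀ j, m • B.coord j ∈ dualLattice N := by
  let b' : Module.Basis κ ℝ V := b.reindex (b.indexEquiv B)
  have hN' : Submodule.span ℤ (Set.range b') = N := by
    rw [← hN, Module.Basis.range_reindex]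
  choose A hA using fun (k j : κ) => exists_int_repr b' (hN' ▸ hB j) k
  have hmul : B.toMatrix b' * b'.toMatrix B = 1 := B.toMatrix_mul_toMatrix_flip b'
  have hAM : (Matrix.of A).map (Int.castRingHom ℝ) = b'.toMatrix B := by
    ext k j
    simp [Module.Basis.toMatrix_apply, hA]
  have hdet : ((Matrix.of A).det : ℝ) = (b'.toMatrix B).det := by
    rw [← hAM, ← RingHom.mapMatrix_apply, ← RingHom.map_det]
    rfl
  -- Cramer's rule: determinant times inverse is the adjugate, which is integral because A is.
  have hinv : ((Matrix.of A).det : ℝ) • B.toMatrix b' =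
      (Matrix.of A).adjugate.map (Int.castRingHom ℝ) := by
    rw [← RingHom.mapMatrix_apply, RingHom.map_adjugate, RingHom.mapMatrix_apply, hAM, hdet]
    calc (b'.toMatrix B).det • B.toMatrix b'
        = (b'.toMatrix B).adjugate * b'.toMatrix B * B.toMatrix b' := by
          rw [Matrix.adjugate_mul, Matrix.smul_mul, one_mul]
      _ = (b'.toMatrix B).adjugate := by
          rw [mul_assoc, b'.toMatrix_mul_toMatrix_flip B, mul_one]
  refine ⟨(Matrix.of A).det, ?_, fun j x hx => ?_⟩
  · rw [hdet]
    intro h0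
    have := congrArg Matrix.det hmul
    rw [Matrix.det_mul, h0, mul_zero, Matrix.det_one] at this
    exact zero_ne_one this
  · choose c hc using fun k => exists_int_repr b' (hN' ▸ hx) k
    refine ⟨∑ k, (Matrix.of A).adjugate j k * c k, ?_⟩
    have hx' := b'.sum_repr x
    simp only [hc] at hx'
    rw [← hx']
    simp only [map_sum, map_smul, LinearMap.smul_apply, Int.cast_sum, Int.cast_mul,
      Module.Basis.coord_apply, smul_eq_mul]
    refine Finset.sum_congr rfl fun k _ => ?_
    have h := congrFun (congrFun hinv j) k
    simp only [Matrix.smul_apply, Module.Basis.toMatrix_apply, smul_eq_mul, Matrix.map_apply] at h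
    have h' : ((Matrix.of A).det : ℝ) * (B.repr (b' k)) j =
      (((Matrix.of A).adjugate j k : ℤ) : ℝ) := h
    rw [← h']
    ring

end Lattice

/-! ### Lattice counts: reduction to wall sums, reciprocity, polynomiality. -/

theorem eventually_forall_pos_and_forall_lt_one {ι : Type*} [Finite ι] :
    ∀ᶠ ε in nhdsWithin (0 : ι → ℝ) {ε | ∀ i, 0 < ε i}, (∀ i, 0 < ε i) ∧ ∀ i, ε i < 1 := by
  refine Filter.Eventually.and self_mem_nhdsWithin
    (mem_nhdsWithin_of_mem_nhds (Filter.eventually_all.2 fun i => ?_))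
  exact (continuous_apply i).continuousAt.eventually_lt continuousAt_const (by simp)

namespace SimpleMultiPolytope

variable {V : Type*} [AddCommGroup V] [Module ℝ V] [FiniteDimensional ℝ V]
  {N : Submodule ℤ V} {ι : Type*} [DecidableEq ι]

theorem vertex_edge (P : SimpleMultiPolytope N ι) (I : P.fan.facets) (i : I.1) :
    P.vertex I (P.fan.edge i) = P.offset i :=
  (P.mem_hyperplanes_iff I (P.vertex I)).2 rfl i

theorem edge_mem (P : SimpleMultiPolytope N ι) {I : Finset ι} (hI : I ∈ P.fan.facets) {i : ι}
    (hi : i ∈ I) : P.fan.edge i ∈ N :=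
  (P.primitive i (P.fan.down_closed I (SimplicialMultiFan.mem_simplices_of_mem_facets hI) _
    (Finset.singleton_subset_iff.2 hi))).1

/-- The coefficient of u - u_I along (u_i^I)⁺ is ⟨u, v_i⟩ - c_i up to the sign chosen by v. -/
theorem mem_dualCone_iff (P : SimpleMultiPolytope N ι) (v : V) (I : P.fan.facets)
    (u : Module.Dual ℝ V) : u ∈ P.dualCone v I ↔
      ∀ i : I.1, 0 ≤ (u (P.fan.edge i) - P.offset i) *
        (if 0 < P.fan.dualVec I i v then 1 else -1) := by
  have hpos : ∀ i : I.1, P.posDualVec v I i =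
      (if 0 < P.fan.dualVec I i v then (1 : ℝ) else -1) • P.fan.dualVec I i := by
    intro i
    by_cases h : 0 < P.fan.dualVec I i v
    · rw [posDualVec, if_pos h, if_pos h, one_smul]
    · rw [posDualVec, if_neg h, if_neg h]
      exact (neg_one_smul ℝ _).symm
  have heval : ∀ (r : I.1 → ℝ) (j : I.1), (P.vertex I + ∑ i, r i • P.posDualVec v I i)
      (P.fan.edge j) = P.offset j + r j * (if 0 < P.fan.dualVec I j v then 1 else -1) := by
    intro r j
    simp only [LinearMap.add_apply, LinearMap.sum_apply, LinearMap.smul_apply, hpos, smul_eq_mul,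
      P.fan.dualVec_edge, vertex_edge]
    rw [Finset.sum_eq_single j (fun i _ hij => by rw [if_neg hij]; ring) (by simp), if_pos rfl]
    ring
  constructor
  · rintro ⟨r, hr, rfl⟩ i
    rw [heval, add_sub_cancel_left]
    split_ifs <;> simpa using hr i
  · intro h
    refine ⟨_, h, (P.fan.facetBasis I).ext fun j => ?_⟩
    rw [P.fan.facetBasis_apply, heval]
    split_ifs <;> simp

/-- Factor by factor: if v has positive i-th coordinate, the signed indicator is -[⟨u, v_i⟩ ≥ c_i],
which is [⟨u, v_i⟩ ≤ c_i] - 1 off the hyperplane; otherwise it is [⟨u, v_i⟩ ≤ c_i] itself. -/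
theorem dh_eq_wallSum (P : SimpleMultiPolytope N ι) (v : V) {u : Module.Dual ℝ V}
    (hu : ∀ I ∈ P.fan.facets, ∀ i ∈ I, u (P.fan.edge i) ≠ P.offset i) :
    P.dh v u = P.fan.wallSum v fun i => if u (P.fan.edge i) ≤ P.offset i then 1 else 0 := by
  classical
  refine Eq.trans ?_ (Finset.sum_coe_sort P.fan.facets _)
  refine Finset.sum_congr rfl fun I _ => ?_
  have hsign : P.facetSign v I = ∏ i : I.1, if 0 < P.fan.dualVec I i v then -1 else 1 := by
    rw [facetSign, Finset.prod_ite]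
    simp
  have hind : (P.dualCone v I).indicator (fun _ => (1 : ℤ)) u = ∏ i : I.1,
      if 0 ≤ (u (P.fan.edge i) - P.offset i) * (if 0 < P.fan.dualVec I i v then 1 else -1)
        then 1 else 0 := by
    rw [Finset.prod_ite_zero, Set.indicator_apply]
    simp only [mem_dualCone_iff, Finset.mem_univ, true_imp_iff, Finset.prod_const_one]
  rw [hsign, hind, mul_comm (∏ i : I.1, _) (P.fan.weight I.1), mul_assoc, ← Finset.prod_mul_distrib,
    ← Finset.prod_coe_sort I.1]
  congr 1
  refine Finset.prod_congr rfl fun i _ => ?_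
  rw [P.fan.coordAt_coe v I i]
  have hne := hu I.1 I.2 i.1 i.2
  by_cases ha : 0 < P.fan.dualVec I i v
  · rcases lt_or_gt_of_ne hne with h | h
    · simp [ha, h, h.le]
    · simp [ha, h.not_ge, h.le]
  · simp [ha]

/-- The sum over the dual lattice of the values of `χ` on one or the other side of the
hyperplanes has finite support. -/
theorem finite_support_wallSum (P : SimpleMultiPolytope N ι) {κ : Type*} [Finite κ]
    (b : Module.Basis κ ℝ V) (hb : ∀ k, b k ∈ N) {v : V} (hv : P.fan.IsGeneric v) (c : ι → ℝ)
    (χ : Module.Dual ℝ V → ι → ℤ)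
    (hχ : ∀ u i, (χ u i = 1 ∧ u (P.fan.edge i) ≤ c i) ∨ (χ u i = 0 ∧ c i ≤ u (P.fan.edge i))) :
    (Function.support fun u : dualLatticeSubgroup N => P.fan.wallSum v (χ u.1)).Finite := by
  choose R hR using fun k => P.complete.bounded_of_wallSum_ne_zero c (b k)
  exact (finite_setOf_abs_le b hb R).subset fun u hu k => hR k u.1 _ v hv (hχ u.1) hu

theorem side_le (P : SimpleMultiPolytope N ι) (c : ι → ℝ) (u : Module.Dual ℝ V) (i : ι) :
    ((if u (P.fan.edge i) ≤ c i then 1 else 0 : ℤ) = 1 ∧ u (P.fan.edge i) ≤ c i) ∨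
      ((if u (P.fan.edge i) ≤ c i then 1 else 0 : ℤ) = 0 ∧ c i ≤ u (P.fan.edge i)) := by
  by_cases h : u (P.fan.edge i) ≤ c i
  · exact Or.inl ⟨if_pos h, h⟩
  · exact Or.inr ⟨if_neg h, (not_le.1 h).le⟩

theorem side_lt (P : SimpleMultiPolytope N ι) (c : ι → ℝ) (u : Module.Dual ℝ V) (i : ι) :
    ((if u (P.fan.edge i) < c i then 1 else 0 : ℤ) = 1 ∧ u (P.fan.edge i) ≤ c i) ∨
      ((if u (P.fan.edge i) < c i then 1 else 0 : ℤ) = 0 ∧ c i ≤ u (P.fan.edge i)) := by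
  by_cases h : u (P.fan.edge i) < c i
  · exact Or.inl ⟨if_pos h, h.le⟩
  · exact Or.inr ⟨if_neg h, not_lt.1 h⟩

/-- The sum over `N*` of the Duistermaat-Heckman function of `νP`, taken to be upper
semicontinuous along the hyperplanes. -/
def closedCount (P : SimpleMultiPolytope N ι) (v : V) (ν : ℤ) : ℤ :=
  ∑ᶠ u : dualLatticeSubgroup N,
    P.fan.wallSum v fun i => if u.1 (P.fan.edge i) ≤ ν * P.offset i then 1 else 0

/-- The sum over `N*` of the Duistermaat-Heckman function of `νP`, with the other convention
along the hyperplanes. -/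
def openCount (P : SimpleMultiPolytope N ι) (v : V) (ν : ℤ) : ℤ :=
  ∑ᶠ u : dualLatticeSubgroup N,
    P.fan.wallSum v fun i => if u.1 (P.fan.edge i) < ν * P.offset i then 1 else 0

/-- Under u ↦ -u the condition "< ν c_i" becomes the negation of "≤ -ν c_i", that is, χ becomes 1 -
χ; `wallSum_neg` supplies the sign and completeness undoes the reversal of v. -/
theorem openCount_eq (P : SimpleMultiPolytope N ι) {v : V} (hv : P.fan.IsGeneric v) (ν : ℤ) :
    P.openCount v ν = (-1) ^ Module.finrank ℝ V * P.closedCount v (-ν) := by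
  rw [openCount, closedCount, mul_finsum, ← finsum_comp_equiv (Equiv.neg _)]
  refine finsum_congr fun u => ?_
  rw [← SimplicialMultiFan.wallSum_neg hv, P.complete.wallSum_eq hv hv.neg]
  congr 1
  funext i
  have h : (Equiv.neg (dualLatticeSubgroup N) u).1 (P.fan.edge i) < ν * P.offset i ↔
      ¬ u.1 (P.fan.edge i) ≤ (-ν : ℤ) * P.offset i := by
    change -(u.1 (P.fan.edge i)) < _ ↔ _
    rw [not_le, Int.cast_neg, neg_mul]
    exact neg_lt
  by_cases h' : u.1 (P.fan.edge i) ≤ (-ν : ℤ) * P.offset i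
  · rw [if_neg fun hh => h.1 hh h', if_pos h']; rfl
  · rw [if_pos (h.2 h'), if_neg h']; rfl

theorem closedCount_zero (P : SimpleMultiPolytope N ι) {v : V} (hv : P.fan.IsGeneric v) :
    P.closedCount v 0 = P.fan.degree := by
  rw [closedCount, finsum_eq_single _ 0]
  · rw [SimplicialMultiFan.degree_eq_degreeAt P.complete hv.neg, ← SimplicialMultiFan.wallSum_one hv]
    congr 1
    funext i
    simp
  · intro u hu
    -- All vertices of 0·P are the origin, so a nonzero value at u requires u ≥ 0 on every generic
    -- vector. A nonzero u is negative on some generic g or on -g.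
    have hker : LinearMap.ker u.1 ≠ ⊤ := fun h => hu (Subtype.ext (LinearMap.ker_eq_top.1 h))
    obtain ⟨g, hg, hgu⟩ := P.fan.exists_isGeneric_notMem hker
    have key : ∀ g', P.fan.IsGeneric g' → u.1 g' < 0 → P.fan.wallSum v (fun i =>
        if u.1 (P.fan.edge i) ≤ (0 : ℤ) * P.offset i then 1 else 0) = 0 := by
      intro g' hg' hneg
      by_contra hne
      rw [P.complete.wallSum_eq hv hg'] at hne
      obtain ⟨I, _, hle⟩ := SimplicialMultiFan.exists_vertex_le_of_wallSum_ne_zero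
        (P.side_le (fun i => (0 : ℤ) * P.offset i) u.1) hne
      simp only [Int.cast_zero, zero_mul, mul_zero, Finset.sum_const_zero] at hle
      exact absurd hneg (not_lt.2 hle)
    rcases lt_or_gt_of_ne (fun h => hgu (LinearMap.mem_ker.2 h) : u.1 g ≠ 0) with h | h
    · exact key g hg h
    · exact key (-g) hg.neg (by simpa using h)

theorem exists_int_offset (P : SimpleMultiPolytope N ι) (hP : P.IsLattice) {I : Finset ι}
    (hI : I ∈ P.fan.facets) {i : ι} (hi : i ∈ I) : ∃ m : ℤ, P.offset i = m := by
  rw [← P.vertex_edge ⟨I, hI⟩ ⟨i, hi⟩]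
  exact hP ⟨I, hI⟩ _ (P.edge_mem hI hi)

/-- Both ⟨u, v_i⟩ and ν c_i are integers, so a displacement strictly between 0 and 1 puts the points
of the i-th hyperplane on its ≤ side and lets no other lattice point cross it. -/
theorem dh_shift_scale (P : SimpleMultiPolytope N ι) (hP : P.IsLattice) (ν : ℤ) (v : V)
    {ε : ι → ℝ} (h0 : ∀ i, 0 < ε i) (h1 : ∀ i, ε i < 1) (u : dualLatticeSubgroup N) :
    ((P.scale ν).shift ε).dh v u.1 =
      P.fan.wallSum v fun i => if u.1 (P.fan.edge i) ≤ ν * P.offset i then 1 else 0 := by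
  have key : ∀ I ∈ P.fan.facets, ∀ i ∈ I,
      u.1 (P.fan.edge i) ≠ ν * P.offset i + ε i ∧
      (u.1 (P.fan.edge i) ≤ ν * P.offset i + ε i ↔ u.1 (P.fan.edge i) ≤ ν * P.offset i) := by
    intro I hI i hi
    obtain ⟨m, hm⟩ := u.2 _ (P.edge_mem hI hi)
    obtain ⟨k, hk⟩ := P.exists_int_offset hP hI hi
    have h0 := h0 i
    have h1 := h1 i
    rw [hm, hk, ← Int.cast_mul]
    rcases le_or_gt m (ν * k) with h | h
    · have h' : (m : ℝ) ≤ (ν * k : ℤ) := by exact_mod_cast h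
      exact ⟨by linarith, by constructor <;> intro <;> linarith⟩
    · have h' : ((ν * k : ℤ) : ℝ) + 1 ≤ m := by exact_mod_cast h
      exact ⟨by linarith, by constructor <;> intro <;> linarith⟩
  have h := ((P.scale ν).shift ε).dh_eq_wallSum v fun I hI i hi => (key I hI i hi).1
  exact h.trans (P.fan.wallSum_congr v fun I hI i hi => if_congr (key I hI i hi).2 rfl rfl)

theorem dh_shift_neg_scale (P : SimpleMultiPolytope N ι) (hP : P.IsLattice) (ν : ℤ) (v : V)
    {ε : ι → ℝ} (h0 : ∀ i, 0 < ε i) (h1 : ∀ i, ε i < 1) (u : dualLatticeSubgroup N) :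
    ((P.scale ν).shift (-ε)).dh v u.1 =
      P.fan.wallSum v fun i => if u.1 (P.fan.edge i) < ν * P.offset i then 1 else 0 := by
  have key : ∀ I ∈ P.fan.facets, ∀ i ∈ I,
      u.1 (P.fan.edge i) ≠ ν * P.offset i + -ε i ∧
      (u.1 (P.fan.edge i) ≤ ν * P.offset i + -ε i ↔ u.1 (P.fan.edge i) < ν * P.offset i) := by
    intro I hI i hi
    obtain ⟨m, hm⟩ := u.2 _ (P.edge_mem hI hi)
    obtain ⟨k, hk⟩ := P.exists_int_offset hP hI hi
    have h0 := h0 i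
    have h1 := h1 i
    rw [hm, hk, ← Int.cast_mul]
    rcases lt_or_ge m (ν * k) with h | h
    · have h' : (m : ℝ) + 1 ≤ (ν * k : ℤ) := by exact_mod_cast h
      exact ⟨by linarith, by constructor <;> intro <;> linarith⟩
    · have h' : ((ν * k : ℤ) : ℝ) ≤ m := by exact_mod_cast h
      exact ⟨by linarith, by constructor <;> intro <;> linarith⟩
  have h := ((P.scale ν).shift (-ε)).dh_eq_wallSum v fun I hI i hi => (key I hI i hi).1
  exact h.trans (P.fan.wallSum_congr v fun I hI i hi => if_congr (key I hI i hi).2 rfl rfl)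

theorem hasLatticeSum_of_subtype (P : SimpleMultiPolytope N ι) {f : dualLatticeSubgroup N → ℤ}
    (hf : f.support.Finite) (h : ∀ v, P.fan.IsGeneric v → ∀ u, P.dh v u.1 = f u) :
    P.HasLatticeSum (∑ᶠ u, f u) := by
  intro v hv
  constructor
  · refine (hf.image Subtype.val).subset ?_
    rintro u ⟨hu, hne⟩
    refine ⟨⟨u, hu⟩, ?_, rfl⟩
    rw [Function.mem_support, ← h v hv]
    exact hne
  · rw [← finsum_set_coe_eq_finsum_mem]
    exact finsum_congr fun u => h v hv u

theorem isLatticeCount_closedCount [Finite ι] (P : SimpleMultiPolytope N ι) (hP : P.IsLattice)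
    {κ : Type*} [Finite κ] (b : Module.Basis κ ℝ V) (hb : ∀ k, b k ∈ N) {v : V}
    (hv : P.fan.IsGeneric v) (ν : ℤ) : (P.scale ν).IsLatticeCount (P.closedCount v ν) := by
  filter_upwards [eventually_forall_pos_and_forall_lt_one] with ε hε
  have hfin := P.finite_support_wallSum b hb hv _ _ (P.side_le fun i => ν * P.offset i)
  exact hasLatticeSum_of_subtype _ hfin fun v' hv' u =>
    (P.dh_shift_scale hP ν v' hε.1 hε.2 u).trans (P.complete.wallSum_eq hv' hv _)

theorem isInteriorLatticeCount_openCount [Finite ι] (P : SimpleMultiPolytope N ι)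
    (hP : P.IsLattice) {κ : Type*} [Finite κ] (b : Module.Basis κ ℝ V) (hb : ∀ k, b k ∈ N) {v : V}
    (hv : P.fan.IsGeneric v) (ν : ℤ) :
    (P.scale ν).IsInteriorLatticeCount (P.openCount v ν) := by
  filter_upwards [eventually_forall_pos_and_forall_lt_one] with ε hε
  have hfin := P.finite_support_wallSum b hb hv _ _ (P.side_lt fun i => ν * P.offset i)
  exact hasLatticeSum_of_subtype _ hfin fun v' hv' u =>
    (P.dh_shift_neg_scale hP ν v' hε.1 hε.2 u).trans (P.complete.wallSum_eq hv' hv _)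

theorem exists_polynomial_closedCount (P : SimpleMultiPolytope N ι) (hP : P.IsLattice)
    {κ : Type*} [Finite κ] (b : Module.Basis κ ℝ V) (hN : Submodule.span ℤ (Set.range b) = N)
    {v : V} (hv : P.fan.IsGeneric v) :
    ∃ p : Polynomial ℝ, ∀ ν : ℤ, p.eval (ν : ℝ) = P.closedCount v ν := by
  classical
  have hb : ∀ k, b k ∈ N := fun k => hN ▸ Submodule.subset_span ⟨k, rfl⟩
  choose m hm0 hm using fun I : P.fan.facets => exists_multiple_dual_basis b hN
    (P.fan.facetBasis I) fun i => by
      rw [P.fan.facetBasis_apply]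
      exact P.edge_mem I.2 i.2
  -- The edges of a facet need not generate N, so its dual basis is scaled by m I to land in N*.
  let w : P.fan.facets → ι → dualLatticeSubgroup N := fun I i =>
    if h : i ∈ I.1 then ⟨m I • P.fan.dualVec I ⟨i, h⟩, hm I ⟨i, h⟩⟩ else 0
  have hw : ∀ (I : P.fan.facets), ∀ i ∈ I.1, ∀ j ∈ I.1,
      evalDualLattice N (P.fan.edge i) (w I j) = if i = j then m I else 0 := by
    intro I i hi j hj
    have := P.fan.dualVec_edge I ⟨j, hj⟩ ⟨i, hi⟩
    simp only [evalDualLattice_apply, w, dif_pos hj, LinearMap.smul_apply, smul_eq_mul, this,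
      Subtype.mk.injEq, mul_ite, mul_one, mul_zero, eq_comm]
  let g : P.fan.facets → ι → ℝ → ℝ := fun I i x =>
    (if x ≤ 0 then 1 else 0) - if 0 < P.fan.coordAt v I i then 1 else 0
  let ψ : P.fan.facets → dualLatticeSubgroup N → ℝ := fun I u =>
    P.fan.weight I.1 * ∏ i ∈ I.1, g I i (evalDualLattice N (P.fan.edge i) u)
  let p : P.fan.facets → dualLatticeSubgroup N := fun I => ⟨P.vertex I, hP I⟩
  have hF : ∀ (ν : ℤ) (u : dualLatticeSubgroup N), ∑ I, ψ I (u - ν • p I) =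
      ((P.fan.wallSum v fun i => if u.1 (P.fan.edge i) ≤ ν * P.offset i then 1 else 0 : ℤ) : ℝ) := by
    intro ν u
    rw [SimplicialMultiFan.wallSum, ← Finset.sum_coe_sort P.fan.facets]
    push_cast
    refine Finset.sum_congr rfl fun I _ => ?_
    refine congrArg _ (Finset.prod_congr rfl fun i hi => ?_)
    have hx : evalDualLattice N (P.fan.edge i) (u - ν • p I) =
        u.1 (P.fan.edge i) - ν * P.offset i := by
      rw [map_sub, map_zsmul, evalDualLattice_apply, evalDualLattice_apply, zsmul_eq_mul]
      rw [show (p I).1 (P.fan.edge i) = P.offset i from P.vertex_edge I ⟨i, hi⟩]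
    simp only [g, hx, sub_nonpos]
  -- The common operator uses the translations of all facets. Each is nonzero on v precisely because
  -- v is generic, so the difference equations are solvable.
  have hs : ∀ x ∈ ∑ I : P.fan.facets, I.1.val.map (w I), evalDualLattice N v x ≠ 0 := by
    intro x hx
    obtain ⟨I, -, hx⟩ := Multiset.mem_sum.1 hx
    obtain ⟨j, hj, rfl⟩ := Multiset.mem_map.1 hx
    have hj : j ∈ I.1 := hj
    have : evalDualLattice N v (w I j) = m I * P.fan.coordAt v I j := by
      simp only [evalDualLattice_apply, w, dif_pos hj, LinearMap.smul_apply, smul_eq_mul]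
      rw [P.fan.coordAt_coe v I ⟨j, hj⟩]
    rw [this]
    exact mul_ne_zero (hm0 I) (hv.coordAt_ne_zero I.2 hj)
  have hψ : ∀ I ∈ (Finset.univ : Finset P.fan.facets),
      (translationDiffs (∑ I : P.fan.facets, I.1.val.map (w I)) (ψ I)).support.Finite := by
    intro I _
    -- The differences of I alone already make ψ I finitely supported, and the remaining ones
    -- preserve this.
    rw [← Finset.add_sum_erase _ _ (Finset.mem_univ I), add_comm, translationDiffs_add]
    refine finite_support_translationDiffs ?_ _
    rw [translationDiffs_const_mul, translationDiffs_prod I.1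
      (fun i => evalDualLattice N (P.fan.edge i)) (w I) (fun _ => m I) (hw I) (g I) subset_rfl]
    refine (finite_setOf_abs_le (P.fan.facetBasis I) (fun i => by
      rw [P.fan.facetBasis_apply]
      exact P.edge_mem I.2 i.2) fun _ => |m I|).subset fun u hu i => ?_
    have hne := Finset.prod_ne_zero_iff.1 (right_ne_zero_of_mul hu) i.1 i.2
    rw [if_pos i.2] at hne
    rw [P.fan.facetBasis_apply]
    simp only [g, evalDualLattice_apply, sub_sub_sub_cancel_right] at hne
    by_contra hlt
    rw [not_le] at hlt
    apply hne
    -- Once |x| > |m I|, the points x and x - m I lie on the same side of 0 and the step function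
    -- has zero difference.
    rcases lt_abs.1 hlt with h | h
    · have h1 := le_abs_self (m I)
      have h2 := abs_nonneg (m I)
      rw [if_neg (by linarith), if_neg (by linarith), sub_self]
    · have h1 := neg_abs_le (m I)
      have h2 := abs_nonneg (m I)
      rw [if_pos (by linarith), if_pos (by linarith), sub_self]
  have hfin : ∀ ν : ℤ, (Function.support fun u => ∑ I, ψ I (u - ν • p I)).Finite := by
    intro ν
    simp only [hF]
    refine (P.finite_support_wallSum b hb hv _ _
      (P.side_le fun i => ν * P.offset i)).subset fun u hu => ?_
    exact fun h => hu (by simp [h])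
  obtain ⟨Q, hQ⟩ := exists_polynomial_finsum_eq Finset.univ ψ p (evalDualLattice N v) _
    hs hψ hfin
  refine ⟨Q, fun ν => ?_⟩
  rw [hQ, closedCount]
  exact (finsum_congr fun u => hF ν u).trans ((Int.castAddHom ℝ).map_finsum
    (P.finite_support_wallSum b hb hv _ _ (P.side_le fun i => ν * P.offset i))).symm

end SimpleMultiPolytope

/-! ### The volume as leading coefficient. -/

open Filter Topology Polynomial in
/-- A real polynomial with `p(k) / k^n → a` has degree at most `n` and `n`-th coefficient `a`. -/
theorem Polynomial.natDegree_le_and_coeff_eq_of_tendsto {p : ℝ[X]} {n : ℕ} {a : ℝ}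
    (h : Tendsto (fun k : ℕ => p.eval (k : ℝ) / (k : ℝ) ^ n) atTop (𝓝 a)) :
    p.natDegree ≤ n ∧ p.coeff n = a := by
  have hX : ∀ x : ℝ, p.eval x / x ^ n = p.eval x / (X ^ n : ℝ[X]).eval x := fun x => by simp
  simp only [hX] at h
  have hdegX : (X ^ n : ℝ[X]).degree = n := degree_X_pow n
  rcases lt_trichotomy p.degree (n : WithBot ℕ) with hd | hd | hd
  · refine ⟨natDegree_le_of_degree_le hd.le, ?_⟩
    rw [coeff_eq_zero_of_degree_lt hd]
    exact tendsto_nhds_unique ((div_tendsto_atTop_zero_of_degree_lt p (X ^ n)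
      (by rwa [hdegX])).comp tendsto_natCast_atTop_atTop) h
  · refine ⟨natDegree_le_of_degree_le hd.le, ?_⟩
    have h1 := (div_tendsto_atTop_leadingCoeff_div_of_degree_eq p (X ^ n)
      (by rw [hdegX, hd])).comp (tendsto_natCast_atTop_atTop (R := ℝ))
    have h2 := tendsto_nhds_unique h1 h
    rw [leadingCoeff_X_pow, div_one, leadingCoeff, natDegree_eq_of_degree_eq_some hd] at h2
    exact h2
  · exact absurd h.abs (not_tendsto_nhds_of_tendsto_atTop
      ((abs_div_tendsto_atTop_atTop_of_degree_gt p (X ^ n) (by rwa [hdegX])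
        (pow_ne_zero _ X_ne_zero)).comp tendsto_natCast_atTop_atTop) _)

section DualCoordinates

variable {V : Type*} [AddCommGroup V] [Module ℝ V] {n : ℕ}

/-- The value at `y` of the linear form with given coordinates, as a function of the
coordinates. -/
def evalCoords (b : Module.Basis (Fin n) ℝ V) (y : V) : (Fin n → ℝ) →ₗ[ℝ] ℝ :=
  LinearMap.applyₗ y ∘ₗ Fintype.linearCombination ℝ fun j => b.coord j

theorem evalCoords_apply (b : Module.Basis (Fin n) ℝ V) (y : V) (x : Fin n → ℝ) :
    evalCoords b y x = (∑ j, x j • b.coord j) y := by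
  simp [evalCoords, Fintype.linearCombination_apply]

theorem evalCoords_basis (b : Module.Basis (Fin n) ℝ V) (k : Fin n) (x : Fin n → ℝ) :
    evalCoords b (b k) x = x k := by
  simp [evalCoords_apply, Finsupp.single_apply]

theorem sum_apply_basis_smul_coord (b : Module.Basis (Fin n) ℝ V) (u : Module.Dual ℝ V) :
    ∑ j, u (b j) • b.coord j = u :=
  b.ext fun k => by simp

open MeasureTheory in
theorem volume_setOf_evalCoords_eq (b : Module.Basis (Fin n) ℝ V) {y : V} (hy : y ≠ 0) (c : ℝ) :
    volume {x : Fin n → ℝ | evalCoords b y x = c} = 0 := by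
  let s : AffineSubspace ℝ (Fin n → ℝ) :=
    { carrier := {x | evalCoords b y x = c}
      smul_vsub_vadd_mem' := by
        intro t p q r hp hq hr
        simp only [Set.mem_ofPred_eq] at hp hq hr
        simp [hp, hq, hr] }
  refine Measure.addHaar_affineSubspace volume s fun hs => hy ?_
  have hall : ∀ x, evalCoords b y x = c := fun x => by
    have : x ∈ s := hs ▸ AffineSubspace.mem_top ℝ _ x
    exact this
  have hc : c = 0 := by rw [← hall 0, map_zero]
  refine b.repr.map_eq_zero_iff.1 (Finsupp.ext fun k => ?_)
  have := hall (Pi.single k 1)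
  rw [hc, evalCoords_apply, Finset.sum_eq_single k] at this
  · simpa using this
  · intro j _ hj
    simp [hj]
  · simp

end DualCoordinates

namespace SimpleMultiPolytope

variable {V : Type*} [AddCommGroup V] [Module ℝ V] [FiniteDimensional ℝ V]
  {N : Submodule ℤ V} {ι : Type*} [DecidableEq ι] {n : ℕ}

/-- The part of a box cut out by prescribing the side of each hyperplane. -/
def cell (P : SimpleMultiPolytope N ι) (b : Module.Basis (Fin n) ℝ V) (R : Fin n → ℝ)
    (T : Finset ι) : Set (Fin n → ℝ) :=
  {x | (∀ j, |x j| ≤ R j) ∧ ∀ i, i ∈ T ↔ evalCoords b (P.fan.edge i) x ≤ P.offset i}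

variable (P : SimpleMultiPolytope N ι) (b : Module.Basis (Fin n) ℝ V) (R : Fin n → ℝ)
  (T : Finset ι)

theorem cell_eq : P.cell b R T = (Set.univ.pi fun j => Set.Icc (-R j) (R j)) ∩
    ⋂ i, if i ∈ T then {x | evalCoords b (P.fan.edge i) x ≤ P.offset i}
      else {x | P.offset i < evalCoords b (P.fan.edge i) x} := by
  ext x
  simp only [cell, Set.mem_ofPred_eq, Set.mem_inter_iff, Set.mem_univ_pi, Set.mem_Icc, abs_le,
    Set.mem_iInter]
  refine and_congr_right fun _ => forall_congr' fun i => ?_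
  by_cases hi : i ∈ T <;> simp [hi]

theorem convex_cell : Convex ℝ (P.cell b R T) := by
  rw [cell_eq]
  refine (convex_pi fun j _ => convex_Icc _ _).inter (convex_iInter fun i => ?_)
  split_ifs
  · exact convex_halfSpace_le (LinearMap.isLinear _) _
  · exact convex_halfSpace_gt (LinearMap.isLinear _) _

theorem measurableSet_cell [Countable ι] : MeasurableSet (P.cell b R T) := by
  rw [cell_eq]
  refine (MeasurableSet.univ_pi fun j => measurableSet_Icc).inter (MeasurableSet.iInter fun i => ?_)
  have hc : Continuous (evalCoords b (P.fan.edge i)) := LinearMap.continuous_of_finiteDimensional _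
  split_ifs
  · exact (isClosed_le hc continuous_const).measurableSet
  · exact (isOpen_lt continuous_const hc).measurableSet

theorem isBounded_cell : Bornology.IsBounded (P.cell b R T) := by
  rw [cell_eq]
  exact (Bornology.IsBounded.pi fun j => Metric.isBounded_Icc _ _).subset Set.inter_subset_left

open Classical in
-- T runs over the possible patterns of sides, and exactly one fits x. Cutting by the box loses
-- nothing since the sum vanishes outside it, and it makes the cells bounded.
theorem wallSum_eq_sum_cell [Fintype ι] (v : V) (x : Fin n → ℝ)
    (hR : P.fan.wallSum v (fun i => if evalCoords b (P.fan.edge i) x ≤ P.offset i then 1 else 0) ≠ 0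
      → ∀ j, |x j| ≤ R j) :
    P.fan.wallSum v (fun i => if evalCoords b (P.fan.edge i) x ≤ P.offset i then 1 else 0) =
      ∑ T : Finset ι, P.fan.wallSum v (fun i => if i ∈ T then 1 else 0) *
        (if x ∈ P.cell b R T then 1 else 0) := by
  let T₀ : Finset ι := Finset.univ.filter fun i => evalCoords b (P.fan.edge i) x ≤ P.offset i
  have hT₀ : ∀ i, i ∈ T₀ ↔ evalCoords b (P.fan.edge i) x ≤ P.offset i := fun i => by simp [T₀]
  have hw : P.fan.wallSum v (fun i => if evalCoords b (P.fan.edge i) x ≤ P.offset i then 1 else 0) =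
      P.fan.wallSum v (fun i => if i ∈ T₀ then 1 else 0) := by
    congr 1
    funext i
    exact (if_congr (hT₀ i) rfl rfl).symm
  rw [Finset.sum_eq_single T₀]
  · rw [hw] at hR ⊢
    by_cases hx : x ∈ P.cell b R T₀
    · rw [if_pos hx, mul_one]
    · rw [if_neg hx, mul_zero]
      by_contra hne
      exact hx ⟨hR hne, hT₀⟩
  · intro T _ hT
    rw [if_neg, mul_zero]
    rintro ⟨-, hx⟩
    exact hT (Finset.ext fun i => (hx i).trans (hT₀ i).symm)
  · simp

open MeasureTheory in
/-- The integral of the Duistermaat-Heckman function, for any generic vector, as a combination of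
volumes of cells. -/
theorem isVolume_sum_cell [Fintype ι] {v : V} (hv : P.fan.IsGeneric v)
    (hR : ∀ x : Fin n → ℝ, P.fan.wallSum v
      (fun i => if evalCoords b (P.fan.edge i) x ≤ P.offset i then 1 else 0) ≠ 0 →
        ∀ j, |x j| ≤ R j) :
    P.IsVolume b (∑ T : Finset ι, (P.fan.wallSum v (fun i => if i ∈ T then 1 else 0) : ℝ) *
      volume.real (P.cell b R T)) := by
  classical
  intro v' hv'
  let G : (Fin n → ℝ) → ℝ := fun x =>
    ∑ T : Finset ι, (P.fan.wallSum v (fun i => if i ∈ T then 1 else 0) : ℝ) *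
      (P.cell b R T).indicator 1 x
  have hint : ∀ T : Finset ι, Integrable ((P.cell b R T).indicator (1 : (Fin n → ℝ) → ℝ)) :=
    fun T => (integrable_indicator_iff (P.measurableSet_cell b R T)).2
      (integrableOn_const ((P.isBounded_cell b R T).measure_lt_top.ne))
  have hG : Integrable G :=
    integrable_finsetSum _ fun T _ => (hint T).const_mul _
  -- An index in no simplex may have zero edge, and its "hyperplane" could then be the whole space;
  -- only indices in facets matter.
  have hnull : ∀ᵐ x : Fin n → ℝ, ∀ i : ι, P.fan.edge i ≠ 0 →
      evalCoords b (P.fan.edge i) x ≠ P.offset i := by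
    refine ae_all_iff.2 fun i => ?_
    by_cases hi : P.fan.edge i = 0
    · simp [hi]
    · rw [ae_iff]
      simpa [hi] using volume_setOf_evalCoords_eq b hi (P.offset i)
  have hae : G =ᵐ[volume] fun x => (P.dh v' (∑ j, x j • b.coord j) : ℝ) := by
    filter_upwards [hnull] with x hx
    rw [P.dh_eq_wallSum v' fun I hI i hi => ?_]
    · simp only [← evalCoords_apply]
      rw [P.complete.wallSum_eq hv' hv, P.wallSum_eq_sum_cell b R v x (hR x)]
      push_cast
      simp only [G, Set.indicator_apply, Pi.one_apply]
    · rw [← evalCoords_apply]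
      exact hx i ((P.fan.linearIndepOn I
        (SimplicialMultiFan.mem_simplices_of_mem_facets hI)).ne_zero hi)
  refine ⟨hG.congr hae, ?_⟩
  rw [← integral_congr_ae hae, integral_finsetSum _ fun T _ => (hint T).const_mul _]
  refine Finset.sum_congr rfl fun T _ => ?_
  rw [integral_const_mul, integral_indicator_one (P.measurableSet_cell b R T)]

open Pointwise in
-- Dividing by k turns the points of N* counted for kP into points of the refined lattice (1/k)ℤ^n
-- in the fixed cells of P.
theorem closedCount_eq_sum_card [Fintype ι] (hN : Submodule.span ℤ (Set.range b) = N) {v : V}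
    (hR : ∀ x : Fin n → ℝ, P.fan.wallSum v
      (fun i => if evalCoords b (P.fan.edge i) x ≤ P.offset i then 1 else 0) ≠ 0 →
        ∀ j, |x j| ≤ R j) (k : ℕ) [NeZero k] :
    P.closedCount v k = ∑ T : Finset ι, P.fan.wallSum v (fun i => if i ∈ T then 1 else 0) *
      Nat.card (P.cell b R T ∩ ((k : ℝ)⁻¹ • Submodule.span ℤ
        (Set.range (Pi.basisFun ℝ (Fin n))) : Submodule ℤ (Fin n → ℝ)) : Set (Fin n → ℝ)) := by
  classical
  have hk : 0 < (k : ℝ) := Nat.cast_pos.2 (NeZero.pos k)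
  have hb : ∀ j, b j ∈ N := fun j => hN ▸ Submodule.subset_span ⟨j, rfl⟩
  let φ : dualLatticeSubgroup N → Fin n → ℝ := fun u j => (k : ℝ)⁻¹ * u.1 (b j)
  have hφ : ∀ (u : dualLatticeSubgroup N) (y : V), evalCoords b y (φ u) = (k : ℝ)⁻¹ * u.1 y := by
    intro u y
    have h : φ u = (k : ℝ)⁻¹ • fun j => u.1 (b j) := rfl
    rw [h, map_smul, evalCoords_apply, sum_apply_basis_smul_coord, smul_eq_mul]
  have hinj : Function.Injective φ := by
    intro u u' h
    refine Subtype.ext (LinearMap.ext fun y => ?_)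
    have := (hφ u y).symm.trans ((congrArg (evalCoords b y) h).trans (hφ u' y))
    exact mul_left_cancel₀ (inv_ne_zero hk.ne') this
  have hpre : ∀ T : Finset ι, φ '' (φ ⁻¹' P.cell b R T) = P.cell b R T ∩ ((k : ℝ)⁻¹ •
      Submodule.span ℤ (Set.range (Pi.basisFun ℝ (Fin n))) : Submodule ℤ (Fin n → ℝ)) := by
    intro T
    rw [Set.image_preimage_eq_inter_range]
    congr 1
    ext x
    rw [SetLike.mem_coe, BoxIntegral.unitPartition.mem_smul_span_iff]
    constructor
    · rintro ⟨u, rfl⟩ j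
      obtain ⟨m, hm⟩ := u.2 _ (hb j)
      exact ⟨m, by simp [φ, ← hm, hk.ne']⟩
    · intro hx
      choose m hm using hx
      refine ⟨⟨∑ j, (k * x j) • b.coord j, fun y hy => ?_⟩, ?_⟩
      · choose l hl using exists_int_repr b (hN ▸ hy)
        exact ⟨∑ j, m j * l j, by simp [← hm, hl]⟩
      · funext j
        have := evalCoords_basis b j fun j => k * x j
        rw [evalCoords_apply] at this
        simp only [φ, this]
        field_simp
  have hfin : ∀ T : Finset ι, (φ ⁻¹' P.cell b R T).Finite := fun T =>
    (finite_setOf_abs_le b hb fun j => k * R j).subset fun u hu j => by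
      have := hu.1 j
      simp only [φ, abs_mul, abs_inv, abs_of_pos hk] at this
      rwa [inv_mul_le_iff₀ hk] at this
  have hterm : ∀ u : dualLatticeSubgroup N,
      P.fan.wallSum v (fun i => if u.1 (P.fan.edge i) ≤ (k : ℤ) * P.offset i then 1 else 0) =
        ∑ T : Finset ι, P.fan.wallSum v (fun i => if i ∈ T then 1 else 0) *
          (φ ⁻¹' P.cell b R T).indicator (fun _ => 1) u := by
    intro u
    simp only [Set.indicator_apply, Set.mem_preimage]
    rw [← P.wallSum_eq_sum_cell b R v (φ u) (hR (φ u))]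
    congr 1
    funext i
    refine if_congr ?_ rfl rfl
    rw [hφ, inv_mul_le_iff₀ hk, Int.cast_natCast]
  rw [closedCount, finsum_congr hterm, finsum_sum_comm]
  · refine Finset.sum_congr rfl fun T _ => ?_
    rw [← mul_finsum, ← hpre T, Nat.card_image_of_injective hinj, Nat.card_coe_set_eq,
      ← finsum_mem_def, ← finsum_one]
    exact congrArg _ ((Nat.castAddMonoidHom ℤ).map_finsum_mem (fun _ => 1) (hfin T)).symm
  · intro T _
    exact (hfin T).subset fun u hu => by
      by_contra hu'
      exact hu (by simp only [Set.indicator_of_notMem hu', mul_zero])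

open MeasureTheory Filter in
-- Cells are bounded and convex, so their frontiers are null and their refined lattice counts,
-- divided by k^n, converge to their volumes. The same combination of cell volumes is the integral
-- of DH.
theorem exists_isVolume_and_tendsto [Fintype ι] (hN : Submodule.span ℤ (Set.range b) = N) {v : V}
    (hv : P.fan.IsGeneric v) :
    ∃ a : ℝ, P.IsVolume b a ∧
      Tendsto (fun k : ℕ => (P.closedCount v k : ℝ) / (k : ℝ) ^ n) atTop (nhds a) := by
  choose R hR' using fun j => P.complete.bounded_of_wallSum_ne_zero P.offset (b j)
  have hR : ∀ x : Fin n → ℝ, P.fan.wallSum v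
      (fun i => if evalCoords b (P.fan.edge i) x ≤ P.offset i then 1 else 0) ≠ 0 →
        ∀ j, |x j| ≤ R j := by
    intro x hx j
    simp only [evalCoords_apply] at hx
    have := hR' j (∑ j, x j • b.coord j) _ v hv (P.side_le P.offset _) hx
    rwa [← evalCoords_apply, evalCoords_basis] at this
  refine ⟨_, P.isVolume_sum_cell b R hv hR, ?_⟩
  have hlim := tendsto_finsetSum (Finset.univ : Finset (Finset ι)) fun T _ =>
    (tendsto_card_div_pow_atTop_volume (P.cell b R T) (P.isBounded_cell b R T)
      (P.measurableSet_cell b R T) ((P.convex_cell b R T).addHaar_frontier volume)).const_mul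
      (P.fan.wallSum v (fun i => if i ∈ T then 1 else 0) : ℝ)
  refine hlim.congr' ?_
  filter_upwards [eventually_gt_atTop 0] with k hk
  have : NeZero k := ⟨hk.ne'⟩
  have h := congrArg (Int.cast : ℤ → ℝ) (P.closedCount_eq_sum_card b R hN hR k)
  push_cast at h
  rw [h, Finset.sum_div]
  refine Finset.sum_congr rfl fun T _ => ?_
  rw [mul_div_assoc, Fintype.card_fin]

end SimpleMultiPolytope

end

/-! ### The main theorem. -/

theorem theorem7p2 {V : Type*} [AddCommGroup V] [Module ℝ V] [FiniteDimensional ℝ V]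
    {n : ℕ} (b : Module.Basis (Fin n) ℝ V) (N : Submodule ℤ V)
    (hN : Submodule.span ℤ (Set.range b) = N)
    {ι : Type*} [Fintype ι] [DecidableEq ι] (P : SimpleMultiPolytope N ι) (hP : P.IsLattice) :
    ∃ count interiorCount : ℤ → ℤ,
      (∀ ν : ℤ, (P.scale ν).IsLatticeCount (count ν)) ∧
      (∀ ν : ℤ, (P.scale ν).IsInteriorLatticeCount (interiorCount ν)) ∧
      (∀ ν : ℤ, interiorCount ν = (-1) ^ n * count (-ν)) ∧
      ∃ p q : Polynomial ℝ, p.natDegree ≤ n ∧ q.natDegree ≤ n ∧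
        (∀ ν : ℤ, p.eval (ν : ℝ) = (count ν : ℝ)) ∧
        (∀ ν : ℤ, q.eval (ν : ℝ) = (interiorCount ν : ℝ)) ∧
        P.IsVolume b (p.coeff n) ∧
        p.coeff 0 = (P.fan.degree : ℝ) := by
  have hb : ∀ k, b k ∈ N := fun k => hN ▸ Submodule.subset_span ⟨k, rfl⟩
  have hn : Module.finrank ℝ V = n := by rw [Module.finrank_eq_card_basis b, Fintype.card_fin]
  obtain ⟨v, hv⟩ := P.fan.exists_isGeneric
  obtain ⟨p, hp⟩ := P.exists_polynomial_closedCount hP b hN hv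
  obtain ⟨a, ha, hlim⟩ := P.exists_isVolume_and_tendsto b hN hv
  obtain ⟨hdeg, hcoeff⟩ := Polynomial.natDegree_le_and_coeff_eq_of_tendsto (p := p) (n := n) (a := a)
    (hlim.congr fun k => by rw [← hp, Int.cast_natCast])
  have hopen : ∀ ν : ℤ, P.openCount v ν = (-1) ^ n * P.closedCount v (-ν) := fun ν => by
    rw [P.openCount_eq hv, hn]
  -- By reciprocity the interior polynomial is (-1)^n p(-X).
  refine ⟨P.closedCount v, P.openCount v, P.isLatticeCount_closedCount hP b hb hv,
    P.isInteriorLatticeCount_openCount hP b hb hv, hopen, p,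
    Polynomial.C ((-1) ^ n) * p.comp (-Polynomial.X), hdeg, ?_, hp, fun ν => ?_, hcoeff ▸ ha, ?_⟩
  · refine (Polynomial.natDegree_C_mul_le _ _).trans ?_
    rwa [Polynomial.natDegree_comp, Polynomial.natDegree_neg, Polynomial.natDegree_X, mul_one]
  · have h := hp (-ν)
    push_cast at h
    rw [hopen]
    simp [Polynomial.eval_comp, h]
  · have h := hp 0
    rwa [Int.cast_zero, ← Polynomial.coeff_zero_eq_eval_zero, P.closedCount_zero hv] at h
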